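/- Let $\alpha>1$ and let $r_1\in(0,\infty]$, with $r_1<\infty$ if $\alpha\le 3$. Let $Y\subset\mathbb R^2$ be a random compact set for which there are constants $a_2>a_1>0$ such that almost surely $D(a_1)\subset Y\subset D(a_2)$ ($D(a)$ is the closed disk of radius $a$ centered at the origin), and such that almost surely the boundary $\partial Y$ has zero Lebesgue measure. For $0<r_0<r_1$ let $R$ be a random variable, independent of $Y$, with density proportional to $r^{-\alpha}\mathbf 1(r_0\le r\le r_1)$. Let $\{(x_i,t_i,X_i)\}$ be the Poisson point process obtained from a homogeneous Poisson process $\{(x_i,t_i)\}$ of intensity one on $\mathbb R^2\times\mathbb R$ by attaching to its points independent copies $X_i=R_iY_i$ of $X=RY$. For $t_i<0$ the visible part of the leaf $x_i+X_i$ is $$V_i=(x_i+X_i)\setminus\bigcup_{t_j\in(t_i,0)}(x_j+\mathrm{int}\,X_j).$$ Let $C_i$ be independent random variables, uniform on $[0,1]$ and independent of the leaves. The uniformly colored dead leaves model $I(r_0,r_1)$ is the random field on $\mathbb R^2$ with value $C_i$ at the points of $\mathrm{int}(V_i)$ that do not belong to $\bigcup_{t_j<0}\partial V_j$, and with value $0$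 on $\bigcup_{t_j<0}\partial V_j$. Let $I(0,r_1)$ be a random field on $\mathbb R^2$ that is the limit of $I(r_0,r_1)$ as $r_0\to0$ in the sense of finite-dimensional distributions. Then: 1. $I(0,r_1)$ is stochastically continuous (that is, for every $x\in\mathbb R^2$, $I(0,r_1)(y)\to I(0,r_1)(x)$ in probability as $y\to x$) if and only if $\alpha\in(1,3)$. 2. $I(0,r_1)$ admits a measurable modification (that is, a jointly measurable random field on the same probability space which at each point $x\in\mathbb R^2$ is almost surely equal to $I(0,r_1)(x)$) if and only if $\alpha\in(1,3)$. 3. If $\alpha\ge 3$, then $I(0,r_1)$ is a white noise: its values at distinct points of $\mathbb R^2$ are independent and all uniformly distributed on $[0,1]$. -/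

import Mathlib

open MeasureTheory ProbabilityTheory Filter Topology TopologicalSpace
open scoped ENNReal NNReal Pointwise

noncomputable section

namespace DeadLeaves

/-- The Euclidean plane. -/
abbrev Plane : Type := EuclideanSpace ℝ (Fin 2)

/-- The Borel σ-algebra of the Fell (hit-or-miss) topology on the closed subsets of the plane; it is
generated by the events `{F | F ∩ K = ∅}` with `K` compact. Random closed sets are the measurable
maps into this space. -/
instance fellMeasurableSpace : MeasurableSpace (Closeds Plane) :=
  MeasurableSpace.generateFrom
    {A | ∃ K : Set Plane, IsCompact K ∧ A = {F : Closeds Plane | (F : Set Plane) ∩ K = ∅}}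

/-! ### Poisson point processes -/

/-- Number of points (with multiplicity) of the sequence `Z` that lie in `B`. -/
def count {Ω S : Type*} (Z : ℕ → Ω → S) (B : Set S) (ω : Ω) : ℝ≥0∞ :=
  ∑' i, B.indicator (fun _ => (1 : ℝ≥0∞)) (Z i ω)

/-- The points `Z 0, Z 1, …` form a Poisson point process on `S` with intensity measure `μ`: the
number of points in a measurable set `B` of finite intensity has the Poisson law with mean `μ B`, and
the numbers of points in disjoint sets are independent. (The processes below have infinite
intensity, so that they can be enumerated by `ℕ`.) -/
structure IsPoissonProcess {Ω S : Type*} [MeasurableSpace Ω] [MeasurableSpace S]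
    (Z : ℕ → Ω → S) (μ : Measure S) (P : Measure Ω) : Prop where
  measurable : ∀ i, Measurable (Z i)
  count_law : ∀ B : Set S, MeasurableSet B → μ B ≠ ∞ →
    HasLaw (count Z B) ((poissonMeasure (μ B).toNNReal).map (fun k : ℕ => (k : ℝ≥0∞))) P
  count_indep : ∀ (n : ℕ) (B : Fin n → Set S), (∀ k, MeasurableSet (B k)) → (∀ k, μ (B k) ≠ ∞) →
    Pairwise (fun k l => Disjoint (B k) (B l)) → iIndepFun (fun k => count Z (B k)) P

/-! ### The dead leaves model -/

/-- A point of the marked process: position `x`, falling time `t`, size `R` and shape `Y`. The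
corresponding grain is `X = R Y`. -/
abbrev Leaf : Type := Plane × ℝ × ℝ × Closeds Plane

namespace Leaf

/-- The position `x` of a leaf. -/
def pos (z : Leaf) : Plane := z.1

/-- The falling time `t` of a leaf. -/
def time (z : Leaf) : ℝ := z.2.1

/-- The size `R` of a leaf. -/
def size (z : Leaf) : ℝ := z.2.2.1

/-- The shape `Y` of a leaf. -/
def shape (z : Leaf) : Closeds Plane := z.2.2.2

/-- The leaf `x + R Y`. -/
def toSet (z : Leaf) : Set Plane := (fun y => z.pos + z.size • y) '' (z.shape : Set Plane)

end Leaf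

/-- The law of the size `R`: the probability measure with density proportional to `r ^ (-α)` on
`r₀ ≤ r ≤ r₁` (with `r₁ = ∞` allowed). -/
def sizeLaw (α r₀ : ℝ) (r₁ : ℝ≥0∞) : Measure ℝ :=
  let m : Measure ℝ := (volume.restrict {r : ℝ | r₀ ≤ r ∧ ENNReal.ofReal r ≤ r₁}).withDensity
    (fun r => ENNReal.ofReal (r ^ (-α)))
  (m Set.univ)⁻¹ • m

/-- The intensity of the marked Poisson process: positions and times are homogeneous with intensity
one, and are independently marked by sizes with law `sizeLaw α r₀ r₁` and independent shapes with
law `Q`. -/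
def leafIntensity (α r₀ : ℝ) (r₁ : ℝ≥0∞) (Q : Measure (Closeds Plane)) : Measure Leaf :=
  (volume : Measure Plane).prod ((volume : Measure ℝ).prod ((sizeLaw α r₀ r₁).prod Q))

/-- The visible part of the `i`-th leaf: what is not covered by the interiors of the leaves that
fall after it and before time `0`. -/
def visiblePart (z : ℕ → Leaf) (i : ℕ) : Set Plane :=
  (z i).toSet \ ⋃ j ∈ {j : ℕ | (z i).time < (z j).time ∧ (z j).time < 0}, interior (z j).toSet

/-- The boundary of the dead leaves tessellation, whose members are the visible parts of the leaves
that fall before time `0`. -/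
def boundary (z : ℕ → Leaf) : Set Plane :=
  ⋃ i ∈ {i : ℕ | (z i).time < 0}, frontier (visiblePart z i)

open Classical in
/-- The value at `x` of the image in which the visible part of the `i`-th leaf has the constant
color `c i`, and which vanishes on the boundary of the tessellation. -/
def coloredImage (z : ℕ → Leaf) (c : ℕ → ℝ) (x : Plane) : ℝ :=
  if h : x ∉ boundary z ∧ ∃ i, (z i).time < 0 ∧ x ∈ interior (visiblePart z i) then
    c (Nat.find h.2)
  else 0

/-- The uniform law on `[0, 1]`. -/
def uniformLaw : Measure ℝ := volume.restrict (Set.Icc 0 1)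

/-- `Φ` and `U` generate the uniformly colored dead leaves model `I(r₀, r₁)`: `Φ` is the marked
Poisson process of the leaves, and the colors `U i` are independent, uniform on `[0, 1]`, and
independent of `Φ`. -/
structure IsUniformlyColoredDeadLeaves {Ω : Type*} [MeasurableSpace Ω] (P : Measure Ω)
    (α r₀ : ℝ) (r₁ : ℝ≥0∞) (Q : Measure (Closeds Plane))
    (Φ : ℕ → Ω → Leaf) (U : ℕ → Ω → ℝ) : Prop where
  leaves : IsPoissonProcess Φ (leafIntensity α r₀ r₁ Q) P
  measurable_color : ∀ i, Measurable (U i)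
  color_law : ∀ i, HasLaw (U i) uniformLaw P
  color_iIndep : iIndepFun U P
  color_indep : IndepFun (fun ω i => Φ i ω) (fun ω i => U i ω) P

/-- The uniformly colored dead leaves random field. -/
def coloredField {Ω : Type*} (Φ : ℕ → Ω → Leaf) (U : ℕ → Ω → ℝ) (x : Plane) (ω : Ω) : ℝ :=
  coloredImage (fun i => Φ i ω) (fun i => U i ω) x

/-! ### Random fields -/

/-- Convergence of finite-dimensional distributions of random fields on the plane. -/
def TendstoFidi {ι : Type*} {Ω : ι → Type*} [∀ i, MeasurableSpace (Ω i)]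
    {Ω' : Type*} [MeasurableSpace Ω'] (Z : ∀ i, Plane → Ω i → ℝ) (l : Filter ι)
    (Z' : Plane → Ω' → ℝ) (P : ∀ i, Measure (Ω i)) [∀ i, IsProbabilityMeasure (P i)]
    (P' : Measure Ω') [IsProbabilityMeasure P'] : Prop :=
  ∀ (n : ℕ) (x : Fin n → Plane),
    TendstoInDistribution (fun i ω (k : Fin n) => Z i (x k) ω) l
      (fun ω (k : Fin n) => Z' (x k) ω) P P'

/-- Stochastic continuity: `Z y → Z x` in probability as `y → x`, for every `x`. -/
def StochasticallyContinuous {Ω : Type*} [MeasurableSpace Ω] (Z : Plane → Ω → ℝ)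
    (P : Measure Ω) : Prop :=
  ∀ x : Plane, TendstoInMeasure P Z (𝓝 x) (Z x)

/-- There is a jointly measurable random field on the same probability space which, at every
point, agrees almost surely with `Z`. -/
def HasMeasurableModification {Ω : Type*} [MeasurableSpace Ω] (Z : Plane → Ω → ℝ)
    (P : Measure Ω) : Prop :=
  ∃ Z' : Plane → Ω → ℝ, Measurable (fun p : Ω × Plane => Z' p.2 p.1) ∧ ∀ x, Z' x =ᵐ[P] Z x

/-- `Z` is a white noise with marginal law `ρ`: its values at distinct points of the plane are
independent, with the common law `ρ`. -/
def IsWhiteNoise {Ω : Type*} [MeasurableSpace Ω] (Z : Plane → Ω → ℝ) (ρ : Measure ℝ)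
    (P : Measure Ω) : Prop :=
  iIndepFun Z P ∧ ∀ x, HasLaw (Z x) ρ P

/-- The admissible lower cut-offs `r₀`, i.e. `0 < r₀ < r₁`. -/
abbrev Cutoff (r₁ : ℝ≥0∞) : Type := {r₀ : ℝ // 0 < r₀ ∧ ENNReal.ofReal r₀ < r₁}

end DeadLeaves

end

/-!
At a fixed point `x` almost every configuration of leaves is regular (`RegularAt`,
`Admissible.ae_regularAt`): `x` is on no boundary of a leaf because the shapes have null boundaries,
only finitely many leaves of a bounded time window come close to `x` because the sizes have a finite
second moment, and some leaf covers `x` because covering it has positive intensity. Hence the value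
of the colored image at `x` is the color of a leaf that is on top at `x`, and its index `topIndex`
is a measurable function of the leaves.

Everything is then decided by the probability that two points `x` and `y` have the same top leaf.
Let a window of time end at `0` and be so long that `x` is covered `K` times on average. By the void
probabilities of the Poisson process, with probability at least `1 - K q - exp (-K)` some leaf of the
window covers `x` and no leaf of the window has its mark in a given set `A` of marks, where `q` is
the intensity of `A` relative to that of covering `x` (`Admissible.exists_time_window`). If `A`
consists of the leaves that cover both points, then on this event the top leaves are distinct; if `A`
consists of the leaves that cover exactly one of them, they coincide. No independence between
time windows is needed, and neither is the exact law of the tessellation. The intensity of covering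
`x` is comparable to the second moment `∫ r ^ (2 - α) dr` over `r₀ ≤ r ≤ r₁`.

* If `α ≥ 3`, this moment diverges as `r₀ → 0`, whereas a leaf that covers two given distinct points
  has a size bounded below, so that such leaves have bounded intensity. Hence the top leaves at
  finitely many points are asymptotically distinct, their colors are asymptotically independent and
  uniform, and the limit is a white noise (`Admissible.isWhiteNoise`).
* If `α < 3`, the moment stays bounded, and the intensity of covering exactly one of `x` and `y`
  tends to `0` as `y → x`, uniformly in `r₀`, by dominated convergence
  (`tendsto_markMeasure_covers_one`). As `{u ≠ v}` is open, the portmanteau theorem bounds the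
  probability that the limit field differs at `x` and `y`
  (`Admissible.stochasticallyContinuous`).

Finally, a stochastically continuous field has a measurable modification: it is the almost sure limit
of fields that are constant on the cells of countable partitions. A uniform white noise is not
stochastically continuous. Nor has it a measurable modification: centered, such a modification would
be a jointly measurable field with orthogonal values, whose integrals over bounded measurable sets
have second moment zero, so that it would vanish almost everywhere
(`ae_ae_eq_zero_of_orthogonal`).
-/

namespace DeadLeaves

/-! ### Void probabilities of a Poisson process -/

section Poisson

lemma count_eq_zero_iff {Ω S : Type*} {Z : ℕ → Ω → S} {B : Set S} {ω : Ω} :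
    count Z B ω = 0 ↔ ∀ i, Z i ω ∉ B := by
  simp [count, ENNReal.tsum_eq_zero, Set.indicator_apply_eq_zero]

lemma finite_of_count_ne_top {Ω S : Type*} {Z : ℕ → Ω → S} {B : Set S} {ω : Ω}
    (h : count Z B ω ≠ ∞) :
    {i | Z i ω ∈ B}.Finite := by
  have h1 := ENNReal.finite_const_le_of_tsum_ne_top h one_ne_zero
  refine h1.subset fun i hi => ?_
  simp only [Set.mem_ofPred_eq] at hi ⊢
  simp [hi]

variable {Ω S : Type*} [MeasurableSpace Ω] [MeasurableSpace S]
  {Z : ℕ → Ω → S} {μ : Measure S} {P : Measure Ω}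

lemma IsPoissonProcess.measure_count_mem (h : IsPoissonProcess Z μ P) {B : Set S}
    (hB : MeasurableSet B) (hμ : μ B ≠ ∞) {C : Set ℝ≥0∞} (hC : MeasurableSet C) :
    P {ω | count Z B ω ∈ C} = poissonMeasure (μ B).toNNReal ((fun k : ℕ => (k : ℝ≥0∞)) ⁻¹' C) := by
  have h1 := h.count_law B hB hμ
  rw [← Measure.map_apply (by fun_prop) hC, ← h1.map_eq,
    Measure.map_apply_of_aemeasurable h1.aemeasurable hC]
  rfl

lemma IsPoissonProcess.measure_forall_notMem (h : IsPoissonProcess Z μ P) {B : Set S}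
    (hB : MeasurableSet B) (hμ : μ B ≠ ∞) :
    P {ω | ∀ i, Z i ω ∉ B} = ENNReal.ofReal (Real.exp (-(μ B).toReal)) := by
  have h1 := h.measure_count_mem hB hμ (measurableSet_singleton 0)
  simp only [Set.mem_singleton_iff, count_eq_zero_iff] at h1
  have h2 : (fun k : ℕ => (k : ℝ≥0∞)) ⁻¹' {0} = {0} := by ext k; simp
  rw [h1, h2, poissonMeasure_singleton]
  simp [ENNReal.coe_toNNReal_eq_toReal]

/-- The probability `1 - exp (-μ B)` of meeting `B` is at most `μ B`. -/
lemma IsPoissonProcess.measure_exists_mem_le [IsProbabilityMeasure P]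
    (h : IsPoissonProcess Z μ P) {B : Set S} (hB : MeasurableSet B) :
    P {ω | ∃ i, Z i ω ∈ B} ≤ μ B := by
  by_cases hμ : μ B = ∞
  · simp [hμ]
  have hm : MeasurableSet {ω | ∀ i, Z i ω ∉ B} := by
    simp only [Set.ofPred_forall]
    exact MeasurableSet.iInter fun i => (h.measurable i hB).compl
  have hc : {ω | ∃ i, Z i ω ∈ B} = {ω | ∀ i, Z i ω ∉ B}ᶜ := by ext ω; simp
  rw [hc, prob_compl_eq_one_sub hm, h.measure_forall_notMem hB hμ]
  rw [← ENNReal.ofReal_one, ← ENNReal.ofReal_sub _ (Real.exp_pos _).le,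
    ← ENNReal.ofReal_toReal hμ, ENNReal.toReal_ofReal ENNReal.toReal_nonneg]
  exact ENNReal.ofReal_le_ofReal (by linarith [Real.add_one_le_exp (-(μ B).toReal)])

lemma IsPoissonProcess.ae_forall_of_ae [IsProbabilityMeasure P]
    (h : IsPoissonProcess Z μ P) {p : S → Prop} (hp : ∀ᵐ s ∂μ, p s) :
    ∀ᵐ ω ∂P, ∀ i, p (Z i ω) := by
  have h0 := (measure_toMeasurable {s | ¬ p s}).trans (ae_iff.1 hp)
  have h1 := h.measure_exists_mem_le (measurableSet_toMeasurable μ {s | ¬ p s})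
  rw [h0, nonpos_iff_eq_zero] at h1
  refine measure_mono_null (fun ω hω => ?_) h1
  obtain ⟨i, hi⟩ := not_forall.1 hω
  exact ⟨i, subset_toMeasurable μ _ hi⟩

lemma IsPoissonProcess.ae_finite (h : IsPoissonProcess Z μ P) {B : Set S}
    (hB : MeasurableSet B) (hμ : μ B ≠ ∞) : ∀ᵐ ω ∂P, {i | Z i ω ∈ B}.Finite := by
  have h1 := h.measure_count_mem hB hμ (measurableSet_singleton ∞)
  have h2 : (fun k : ℕ => (k : ℝ≥0∞)) ⁻¹' {∞} = ∅ := by ext k; simp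
  rw [h2, measure_empty] at h1
  exact measure_mono_null (fun ω hω => by
    by_contra hne
    exact hω (finite_of_count_ne_top hne)) h1

end Poisson

/-! ### Marked points and the points they cover -/

/-- The position, size and shape of a leaf, i.e. everything but its falling time. -/
def Leaf.mark (z : Leaf) : Plane × ℝ × Closeds Plane := (z.1, z.2.2)

/-- The point `x` belongs to the leaf `p + r Y` with mark `m = (p, r, Y)`, expressed through the
rescaled point `r⁻¹ (x - p)`. Marks with `r ≤ 0`, which almost surely do not occur, cover nothing. -/
def Covers (x : Plane) (m : Plane × ℝ × Closeds Plane) : Prop :=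
  0 < m.2.1 ∧ m.2.1⁻¹ • (x - m.1) ∈ m.2.2

lemma measurable_mark : Measurable Leaf.mark := by
  unfold Leaf.mark; fun_prop

lemma measurable_time : Measurable Leaf.time := by
  unfold Leaf.time; fun_prop

lemma measurableSet_disjoint_compact {K : Set Plane} (hK : IsCompact K) :
    MeasurableSet {F : Closeds Plane | (F : Set Plane) ∩ K = ∅} :=
  MeasurableSpace.measurableSet_generateFrom ⟨K, hK, rfl⟩

lemma measurableSet_mem_const (q : Plane) : MeasurableSet {F : Closeds Plane | q ∈ F} := by
  have := (measurableSet_disjoint_compact (isCompact_singleton (x := q))).compl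
  convert this using 1
  ext F
  simp

/-- A point lies off a closed set if and only if it is in one of countably many closed balls that
miss the closed set. -/
lemma measurableSet_mem_closeds : MeasurableSet {q : Plane × Closeds Plane | q.1 ∈ q.2} := by
  obtain ⟨D, hDc, hD⟩ := exists_countable_dense Plane
  have key : {q : Plane × Closeds Plane | q.1 ∈ q.2}ᶜ =
      ⋃ d ∈ D, ⋃ n : ℕ, Metric.ball d (1 / ((n : ℝ) + 1)) ×ˢ
        {F : Closeds Plane | (F : Set Plane) ∩ Metric.closedBall d (1 / ((n : ℝ) + 1)) = ∅} := by
    ext ⟨p, F⟩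
    simp only [Set.mem_compl_iff, Set.mem_ofPred_eq, Set.mem_iUnion, Set.mem_prod, exists_prop]
    constructor
    · intro hp
      obtain ⟨ε, hε, hball⟩ := Metric.isOpen_iff.1 F.isClosed.isOpen_compl p hp
      obtain ⟨n, hn⟩ := exists_nat_one_div_lt (half_pos hε)
      obtain ⟨d, hdD, hd⟩ := hD.exists_dist_lt p (Nat.one_div_pos_of_nat (α := ℝ) (n := n))
      refine ⟨d, hdD, n, hd, ?_⟩
      refine Set.eq_empty_iff_forall_notMem.2 fun y hy => hball (?_ : y ∈ _) hy.1
      have h1 := Metric.mem_closedBall.1 hy.2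
      rw [Metric.mem_ball]
      linarith [dist_triangle y d p, dist_comm d p]
    · rintro ⟨d, -, n, hd, hF⟩ hp
      exact Set.eq_empty_iff_forall_notMem.1 hF p ⟨hp, Metric.ball_subset_closedBall hd⟩
  refine MeasurableSet.of_compl ?_
  rw [key]
  refine MeasurableSet.biUnion hDc fun d _ => MeasurableSet.iUnion fun n => ?_
  exact measurableSet_ball.prod (measurableSet_disjoint_compact (isCompact_closedBall _ _))

/-- A point is interior to a closed set if and only if it has a basic open neighbourhood whose points
in a fixed countable dense set all belong to the closed set. -/
lemma measurableSet_mem_interior :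
    MeasurableSet {q : Plane × Closeds Plane | q.1 ∈ interior (q.2 : Set Plane)} := by
  obtain ⟨D, hDc, hD⟩ := exists_countable_dense Plane
  have key : {q : Plane × Closeds Plane | q.1 ∈ interior (q.2 : Set Plane)} =
      ⋃ b ∈ countableBasis Plane, b ×ˢ ⋂ d ∈ D ∩ b, {F : Closeds Plane | d ∈ F} := by
    ext ⟨p, F⟩
    simp only [Set.mem_ofPred_eq, Set.mem_iUnion, Set.mem_prod, exists_prop, Set.mem_iInter]
    constructor
    · intro hp
      obtain ⟨b, hb, hpb, hbF⟩ := (isBasis_countableBasis Plane).exists_subset_of_mem_open hp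
        isOpen_interior
      exact ⟨b, hb, hpb, fun d hd => interior_subset (hbF hd.2)⟩
    · rintro ⟨b, hb, hpb, hbF⟩
      have hbo := isOpen_of_mem_countableBasis hb
      refine interior_maximal (s := (F : Set Plane)) ?_ hbo hpb
      have h1 : b ⊆ closure (b ∩ D) := hD.open_subset_closure_inter hbo
      refine h1.trans (closure_minimal (fun d hd => hbF d ⟨hd.2, hd.1⟩) F.isClosed)
  rw [key]
  refine MeasurableSet.biUnion (countable_countableBasis _) fun b hb => ?_
  refine (isOpen_of_mem_countableBasis hb).measurableSet.prod ?_
  exact MeasurableSet.biInter (hDc.mono Set.inter_subset_left) fun d _ => measurableSet_mem_const d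

lemma measurableSet_mem_frontier :
    MeasurableSet {q : Plane × Closeds Plane | q.1 ∈ frontier (q.2 : Set Plane)} := by
  have : {q : Plane × Closeds Plane | q.1 ∈ frontier (q.2 : Set Plane)} =
      {q : Plane × Closeds Plane | q.1 ∈ q.2} \
        {q : Plane × Closeds Plane | q.1 ∈ interior (q.2 : Set Plane)} := by
    ext q
    simp [q.2.isClosed.frontier_eq]
  rw [this]
  exact measurableSet_mem_closeds.diff measurableSet_mem_interior

lemma measurable_rescaled (x : Plane) : Measurable
    (fun m : Plane × ℝ × Closeds Plane => (m.2.1⁻¹ • (x - m.1), m.2.2)) := by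
  fun_prop

lemma measurableSet_covers (x : Plane) : MeasurableSet {m | Covers x m} :=
  MeasurableSet.inter (s₁ := {m : Plane × ℝ × Closeds Plane | 0 < m.2.1})
    (measurableSet_lt measurable_const (by fun_prop))
    (measurable_rescaled x measurableSet_mem_closeds)

/-- The positions for which the rescaled point lies in `s` form a reflected and rescaled copy
of `s`. -/
lemma volume_rescaled_preimage (x : Plane) {r : ℝ} (hr : 0 < r) {s : Set Plane}
    (hs : MeasurableSet s) :
    volume {p : Plane | r⁻¹ • (x - p) ∈ s} = ENNReal.ofReal (r ^ 2) * volume s := by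
  have h1 := (Measure.measurePreserving_sub_left (volume : Measure Plane) x).measure_preimage
    (s := (fun y => r⁻¹ • y) ⁻¹' s) (hs.preimage (by fun_prop)).nullMeasurableSet
  have h2 := Measure.addHaar_preimage_smul (volume : Measure Plane) (inv_ne_zero hr.ne') s
  rw [show {p : Plane | r⁻¹ • (x - p) ∈ s} =
    (fun p => x - p) ⁻¹' ((fun y => r⁻¹ • y) ⁻¹' s) from rfl, h1, h2]
  simp [abs_of_pos hr]

lemma volume_covers (x : Plane) {w : ℝ × Closeds Plane} (hr : 0 < w.1) :
    volume {p : Plane | Covers x (p, w)} = ENNReal.ofReal (w.1 ^ 2) * volume (w.2 : Set Plane) := by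
  rw [← volume_rescaled_preimage x hr w.2.isClosed.measurableSet]
  simp [Covers, hr]

section toSet

variable {z : Leaf}

/-- For a leaf of positive size, `toSet` is the preimage of the shape under rescaling. -/
lemma toSet_eq_preimage (hz : 0 < z.size) : z.toSet =
    ((Homeomorph.subRight z.pos).trans (Homeomorph.smulOfNeZero z.size⁻¹ (inv_ne_zero hz.ne'))) ⁻¹'
      (z.shape : Set Plane) := by
  ext x
  simp only [Leaf.toSet, Set.mem_image, Set.mem_preimage, Homeomorph.trans_apply]
  constructor
  · rintro ⟨y, hy, rfl⟩
    simpa [smul_smul, inv_mul_cancel₀ hz.ne'] using hy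
  · intro hx
    exact ⟨_, hx, by simp [smul_smul, mul_inv_cancel₀ hz.ne']⟩

lemma isClosed_toSet (hz : 0 < z.size) : IsClosed z.toSet := by
  rw [toSet_eq_preimage hz]
  exact z.shape.isClosed.preimage (Homeomorph.continuous _)

lemma mem_toSet_iff (hz : 0 < z.size) {x : Plane} : x ∈ z.toSet ↔ Covers x z.mark := by
  rw [toSet_eq_preimage hz]
  exact ⟨fun h => ⟨hz, h⟩, fun h => h.2⟩

lemma mem_frontier_toSet_iff (hz : 0 < z.size) {x : Plane} : x ∈ frontier z.toSet ↔
    z.size⁻¹ • (x - z.pos) ∈ frontier (z.shape : Set Plane) := by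
  rw [toSet_eq_preimage hz, ← Homeomorph.preimage_frontier]
  rfl

end toSet

/-! ### The leaf visible at a point -/

/-- The `i`-th leaf covers `x`, and no leaf falling after it and before time `0` does. -/
def IsTop (z : ℕ → Leaf) (x : Plane) (i : ℕ) : Prop :=
  (z i).time < 0 ∧ Covers x (z i).mark ∧
    ∀ j, (z i).time < (z j).time → (z j).time < 0 → ¬ Covers x (z j).mark

lemma exists_isTop_or (z : ℕ → Leaf) (x : Plane) : ∃ i, IsTop z x i ∨ ∀ j, ¬ IsTop z x j := by
  by_cases h : ∃ i, IsTop z x i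
  · exact h.imp fun i hi => Or.inl hi
  · exact ⟨0, Or.inr (not_exists.1 h)⟩

open Classical in
/-- The first index of a leaf that is on top at `x`, and `0` if there is none. Simultaneous leaves
are not excluded, so that several leaves may be on top. -/
noncomputable def topIndex (x : Plane) (z : ℕ → Leaf) : ℕ := Nat.find (exists_isTop_or z x)

lemma isTop_topIndex {z : ℕ → Leaf} {x : Plane} (h : ∃ i, IsTop z x i) :
    IsTop z x (topIndex x z) := by
  classical
  obtain ⟨i, hi⟩ := h
  exact (Nat.find_spec (exists_isTop_or z x)).resolve_right fun h => h i hi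

lemma topIndex_congr {z : ℕ → Leaf} {x y : Plane} (h : ∀ i, IsTop z x i ↔ IsTop z y i) :
    topIndex x z = topIndex y z := by
  classical
  simp only [topIndex, h]

lemma measurable_topIndex (x : Plane) : Measurable (topIndex x) := by
  classical
  have hc : ∀ i, MeasurableSet {z : ℕ → Leaf | Covers x (z i).mark} := fun i =>
    (measurable_mark.comp (measurable_pi_apply i)) (measurableSet_covers x)
  have ht : ∀ i, Measurable fun z : ℕ → Leaf => (z i).time := fun i =>
    measurable_time.comp (measurable_pi_apply i)
  have hi : ∀ i, MeasurableSet {z : ℕ → Leaf | IsTop z x i} := fun i => by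
    refine (measurableSet_lt (ht i) measurable_const).inter ((hc i).inter ?_)
    change MeasurableSet {z : ℕ → Leaf | _}
    simp only [Set.ofPred_forall]
    refine MeasurableSet.iInter fun j => ?_
    exact (measurableSet_lt (ht i) (ht j)).imp
      ((measurableSet_lt (ht j) measurable_const).imp (hc j).compl)
  refine measurable_find _ fun i => (hi i).union ?_
  change MeasurableSet {z : ℕ → Leaf | _}
  simp only [Set.ofPred_forall]
  exact MeasurableSet.iInter fun j => (hi j).compl

/-- The properties of a configuration of leaves, almost sure at a given point `x`, which ensure that
`x` lies in the interior of a visible part and off the boundary of the tessellation. -/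
structure RegularAt (z : ℕ → Leaf) (x : Plane) : Prop where
  size_pos : ∀ i, 0 < (z i).size
  notMem_frontier : ∀ i, x ∉ frontier (z i).toSet
  finite_hitting : ∀ T : ℕ, {i | (z i).time ∈ Set.Ioo (-(T : ℝ)) 0 ∧
    ((z i).toSet ∩ Metric.closedBall x 1).Nonempty}.Finite
  exists_covers : ∃ i, (z i).time < 0 ∧ Covers x (z i).mark

namespace RegularAt

variable {z : ℕ → Leaf} {x : Plane}

lemma mem_interior (h : RegularAt z x) {i : ℕ} (hi : Covers x (z i).mark) :
    x ∈ interior (z i).toSet := by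
  by_contra hx
  refine h.notMem_frontier i ?_
  rw [(isClosed_toSet (h.size_pos i)).frontier_eq]
  exact ⟨(mem_toSet_iff (h.size_pos i)).2 hi, hx⟩

lemma finite_covers (h : RegularAt z x) (s : ℝ) :
    {i | s < (z i).time ∧ (z i).time < 0 ∧ Covers x (z i).mark}.Finite := by
  obtain ⟨T, hT⟩ := exists_nat_ge (-s)
  refine (h.finite_hitting T).subset fun i hi => ⟨⟨by linarith [hi.1], hi.2.1⟩, x, ?_, by simp⟩
  exact (mem_toSet_iff (h.size_pos i)).2 hi.2.2

lemma exists_isTop_gt (h : RegularAt z x) {s : ℝ} {i : ℕ} (hs : s < (z i).time)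
    (hi : (z i).time < 0) (hc : Covers x (z i).mark) : ∃ j, IsTop z x j ∧ s < (z j).time := by
  obtain ⟨j, hj, hmax⟩ := Set.exists_max_image _ (fun j => (z j).time) (h.finite_covers s)
    ⟨i, hs, hi, hc⟩
  exact ⟨j, ⟨hj.2.1, hj.2.2, fun k hk hk0 hck =>
    absurd (hmax k ⟨hj.1.trans hk, hk0, hck⟩) (not_le.2 hk)⟩, hj.1⟩

lemma exists_isTop (h : RegularAt z x) : ∃ j, IsTop z x j := by
  obtain ⟨i, hi, hc⟩ := h.exists_covers
  obtain ⟨j, hj, -⟩ := h.exists_isTop_gt (sub_one_lt (z i).time) hi hc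
  exact ⟨j, hj⟩

lemma mem_visiblePart_iff (h : RegularAt z x) {i : ℕ} (hi : (z i).time < 0) :
    x ∈ visiblePart z i ↔ IsTop z x i := by
  simp only [visiblePart, IsTop, Set.mem_sdiff, mem_toSet_iff (h.size_pos i), hi, true_and,
    Set.mem_iUnion, exists_prop, not_exists, Set.mem_ofPred_eq, not_and]
  refine and_congr_right fun _ => forall_congr' fun j => ?_
  rw [and_imp]
  refine imp_congr_right fun _ => imp_congr_right fun _ => not_congr ⟨fun hj => ?_, h.mem_interior⟩
  exact (mem_toSet_iff (h.size_pos j)).1 (interior_subset hj)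

/-- Near a point which no later leaf covers, a visible part agrees with its leaf, because only
finitely many of the later leaves come close. -/
lemma notMem_boundary (h : RegularAt z x) : x ∉ boundary z := by
  simp only [boundary, Set.mem_iUnion, exists_prop, not_exists, Set.mem_ofPred_eq, not_and]
  intro i hi hx
  set S := {j : ℕ | (z i).time < (z j).time ∧ (z j).time < 0} with hS
  -- Either a later leaf removes a neighbourhood of `x` from the visible part, or none comes near `x`.
  by_cases hcov : ∃ j ∈ S, Covers x (z j).mark
  · obtain ⟨j, hj, hc⟩ := hcov
    have hdisj : Disjoint (interior (z j).toSet) (visiblePart z i) :=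
      Set.disjoint_left.2 fun y hy hyv => hyv.2 (Set.mem_biUnion hj hy)
    exact Set.disjoint_left.1 (hdisj.closure_right isOpen_interior) (h.mem_interior hc)
      (frontier_subset_closure hx)
  · push Not at hcov
    obtain ⟨T, hT⟩ := exists_nat_ge (-(z i).time)
    have hev : ∀ᶠ y in 𝓝 x, ∀ j ∈ S, y ∉ (z j).toSet := by
      have h1 : ∀ᶠ y in 𝓝 x, ∀ j ∈ {j | (z j).time ∈ Set.Ioo (-(T : ℝ)) 0 ∧
          ((z j).toSet ∩ Metric.closedBall x 1).Nonempty}, j ∈ S → y ∉ (z j).toSet := by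
        rw [eventually_all_finite (h.finite_hitting T)]
        intro j _
        by_cases hj : j ∈ S
        · have := (isClosed_toSet (h.size_pos j)).isOpen_compl.mem_nhds
            (fun hx' => hcov j hj ((mem_toSet_iff (h.size_pos j)).1 hx'))
          filter_upwards [this] with y hy _ using hy
        · exact Eventually.of_forall fun y hj' => absurd hj' hj
      filter_upwards [h1, Metric.closedBall_mem_nhds x one_pos] with y hy hball j hj hyj
      exact hy j ⟨⟨by linarith [hj.1], hj.2⟩, y, hyj, hball⟩ hj hyj
    have heq : visiblePart z i =ᶠ[𝓝 x] (z i).toSet := by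
      filter_upwards [hev] with y hy
      refine propext ⟨fun hv => hv.1, fun hv => ⟨hv, ?_⟩⟩
      simp only [Set.mem_iUnion, not_exists]
      exact fun j hj hyj => hy j hj (interior_subset hyj)
    have h2 : frontier (visiblePart z i) ∩ {x} = frontier (z i).toSet ∩ {x} := by
      obtain ⟨U, hU, hUo, hxU⟩ := mem_nhds_iff.1 heq
      have h3 : visiblePart z i ∩ U = (z i).toSet ∩ U := by
        ext y
        simp only [Set.mem_inter_iff, and_congr_left_iff]
        exact fun hy => Eq.to_iff (hU hy)
      have h4 := frontier_inter_open_inter (s := visiblePart z i) hUo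
      rw [h3, frontier_inter_open_inter hUo] at h4
      ext y
      simp only [Set.mem_inter_iff, Set.mem_singleton_iff, and_congr_left_iff]
      rintro rfl
      have := Set.ext_iff.1 h4 y
      simp only [Set.mem_inter_iff, hxU, and_true] at this
      exact this.symm
    exact h.notMem_frontier i (h2.subset ⟨hx, rfl⟩).1

lemma mem_interior_visiblePart_iff (h : RegularAt z x) {i : ℕ} (hi : (z i).time < 0) :
    x ∈ interior (visiblePart z i) ↔ IsTop z x i := by
  rw [← h.mem_visiblePart_iff hi]
  refine ⟨fun hx => interior_subset hx, fun hx => ?_⟩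
  by_contra hx'
  exact h.notMem_boundary (Set.mem_biUnion (show i ∈ {i | (z i).time < 0} from hi)
    ⟨subset_closure hx, hx'⟩)

lemma coloredImage_eq (h : RegularAt z x) (c : ℕ → ℝ) :
    coloredImage z c x = c (topIndex x z) := by
  classical
  -- `coloredImage` and `topIndex` search for the first index with equivalent properties.
  have hiff : ∀ i, ((z i).time < 0 ∧ x ∈ interior (visiblePart z i)) ↔
      (IsTop z x i ∨ ∀ j, ¬ IsTop z x j) := fun i => by
    obtain ⟨k, hk⟩ := h.exists_isTop
    refine ⟨fun hi => Or.inl ((h.mem_interior_visiblePart_iff hi.1).1 hi.2), ?_⟩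
    rintro (hi | hi)
    · exact ⟨hi.1, (h.mem_interior_visiblePart_iff hi.1).2 hi⟩
    · exact absurd hk (hi k)
  have hex : x ∉ boundary z ∧ ∃ i, (z i).time < 0 ∧ x ∈ interior (visiblePart z i) :=
    ⟨h.notMem_boundary, h.exists_isTop.imp fun i hi => (hiff i).2 (Or.inl hi)⟩
  rw [coloredImage, dif_pos hex]
  congr 1
  simp only [topIndex, hiff]

end RegularAt

/-! ### The second moment of the sizes -/

/-- The measure `r ^ (-α) dr` on `r₀ ≤ r ≤ r₁`, which is proportional to the law of the sizes. -/
noncomputable def powerMeasure (α r₀ : ℝ) (r₁ : ℝ≥0∞) : Measure ℝ :=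
  (volume.restrict {r : ℝ | r₀ ≤ r ∧ ENNReal.ofReal r ≤ r₁}).withDensity
    (fun r => ENNReal.ofReal (r ^ (-α)))

instance (α r₀ : ℝ) (r₁ : ℝ≥0∞) : SFinite (powerMeasure α r₀ r₁) := by
  unfold powerMeasure; infer_instance

/-- The second moment of `powerMeasure`, which governs the area of the leaves. -/
noncomputable def secondMoment (α r₀ : ℝ) (r₁ : ℝ≥0∞) : ℝ≥0∞ :=
  ∫⁻ r, ENNReal.ofReal (r ^ 2) ∂powerMeasure α r₀ r₁

section

variable {α r₀ : ℝ} {r₁ : ℝ≥0∞}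

lemma measurableSet_sizes : MeasurableSet {r : ℝ | r₀ ≤ r ∧ ENNReal.ofReal r ≤ r₁} :=
  (measurableSet_le measurable_const measurable_id).inter
    (measurableSet_le ENNReal.measurable_ofReal measurable_const)

lemma ae_powerMeasure : ∀ᵐ r ∂powerMeasure α r₀ r₁, r₀ ≤ r ∧ ENNReal.ofReal r ≤ r₁ :=
  (withDensity_absolutelyContinuous _ _).ae_le (ae_restrict_mem measurableSet_sizes)

lemma lintegral_powerMeasure {f : ℝ → ℝ≥0∞} (hf : Measurable f) :
    ∫⁻ r, f r ∂powerMeasure α r₀ r₁ =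
      ∫⁻ r in {r : ℝ | r₀ ≤ r ∧ ENNReal.ofReal r ≤ r₁}, ENNReal.ofReal (r ^ (-α)) * f r := by
  rw [powerMeasure, lintegral_withDensity_eq_lintegral_mul _ (by fun_prop) hf]
  rfl

lemma powerMeasure_mono {s : ℝ} (h : s ≤ r₀) :
    powerMeasure α r₀ r₁ ≤ powerMeasure α s r₁ := by
  have h1 : volume.restrict {r : ℝ | r₀ ≤ r ∧ ENNReal.ofReal r ≤ r₁} ≤
      volume.restrict {r : ℝ | s ≤ r ∧ ENNReal.ofReal r ≤ r₁} := by
    refine Measure.restrict_mono ?_ le_rfl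
    exact fun r hr => ⟨h.trans hr.1, hr.2⟩
  refine Measure.le_iff.2 fun A hA => ?_
  rw [powerMeasure, powerMeasure, withDensity_apply _ hA, withDensity_apply _ hA]
  exact lintegral_mono' (Measure.restrict_mono_measure h1 A) le_rfl

lemma secondMoment_anti {s : ℝ} (h : s ≤ r₀) : secondMoment α r₀ r₁ ≤ secondMoment α s r₁ :=
  lintegral_mono' (powerMeasure_mono h) le_rfl

lemma lintegral_rpow_lt_top {β : ℝ} (hβ : β < -1) (h0 : 0 < r₀) :
    ∫⁻ r in {r : ℝ | r₀ ≤ r ∧ ENNReal.ofReal r ≤ r₁}, ENNReal.ofReal (r ^ β) < ∞ := by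
  have h1 : IntegrableOn (fun r : ℝ => r ^ β) (Set.Ioi (r₀ / 2)) :=
    integrableOn_Ioi_rpow_of_lt hβ (half_pos h0)
  refine lt_of_le_of_lt (lintegral_mono_set fun r hr => ?_) h1.lintegral_lt_top
  exact lt_of_lt_of_le (half_lt_self h0) hr.1

lemma powerMeasure_univ_lt_top (hα : 1 < α) (h0 : 0 < r₀) :
    powerMeasure α r₀ r₁ Set.univ < ∞ := by
  rw [powerMeasure, withDensity_apply _ MeasurableSet.univ, Measure.restrict_univ]
  exact lintegral_rpow_lt_top (by linarith) h0

lemma powerMeasure_univ_ne_zero (h0 : 0 < r₀) (h01 : ENNReal.ofReal r₀ < r₁) :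
    powerMeasure α r₀ r₁ Set.univ ≠ 0 := by
  obtain ⟨s, hs0, hs, hs1⟩ := ENNReal.lt_iff_exists_real_btwn.1 h01
  have hrs : r₀ < s := (ENNReal.ofReal_lt_ofReal_iff_of_nonneg h0.le).1 hs
  rw [powerMeasure, withDensity_apply _ MeasurableSet.univ, Measure.restrict_univ]
  intro h
  rw [lintegral_eq_zero_iff (by fun_prop)] at h
  have h2 := ae_restrict_iff' (measurableSet_sizes) |>.1 h
  have h3 : volume (Set.Icc r₀ s) = 0 := by
    refine measure_mono_null (fun r hr => ?_) h2
    intro h4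
    have := h4 ⟨hr.1, (ENNReal.ofReal_le_ofReal hr.2).trans hs1.le⟩
    simp only [Pi.zero_apply, ENNReal.ofReal_eq_zero] at this
    exact absurd (Real.rpow_pos_of_pos (h0.trans_le hr.1) (-α)) (not_lt.2 this)
  simp [Real.volume_Icc] at h3
  linarith

lemma secondMoment_ne_top (hα : 1 < α) (hfin : α ≤ 3 → r₁ ≠ ∞) (h0 : 0 < r₀) :
    secondMoment α r₀ r₁ ≠ ∞ := by
  rcases le_or_gt α 3 with h3 | h3
  · have hle : secondMoment α r₀ r₁ ≤
        ENNReal.ofReal (r₁.toReal ^ 2) * powerMeasure α r₀ r₁ Set.univ := by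
      rw [secondMoment, ← lintegral_const]
      refine lintegral_mono_ae ?_
      filter_upwards [ae_powerMeasure] with r hr
      have hr1 : r ≤ r₁.toReal := (ENNReal.ofReal_le_iff_le_toReal (hfin h3)).1 hr.2
      have : 0 < r := h0.trans_le hr.1
      gcongr
    exact ne_top_of_le_ne_top
      (ENNReal.mul_ne_top ENNReal.ofReal_ne_top (powerMeasure_univ_lt_top hα h0).ne) hle
  · rw [secondMoment, lintegral_powerMeasure (by fun_prop)]
    refine ne_of_lt (lt_of_eq_of_lt (setLIntegral_congr_fun measurableSet_sizes fun r hr => ?_)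
      (lintegral_rpow_lt_top (r₁ := r₁) (show 2 - α < -1 by linarith) h0))
    have hr0 : 0 < r := h0.trans_le hr.1
    rw [← ENNReal.ofReal_mul (by positivity), ← Real.rpow_natCast, ← Real.rpow_add hr0]
    congr 2
    push_cast
    ring

lemma secondMoment_ne_zero (h0 : 0 < r₀) (h01 : ENNReal.ofReal r₀ < r₁) :
    secondMoment α r₀ r₁ ≠ 0 := by
  have hle : ENNReal.ofReal (r₀ ^ 2) * powerMeasure α r₀ r₁ Set.univ ≤ secondMoment α r₀ r₁ := by
    rw [secondMoment, ← lintegral_const]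
    refine lintegral_mono_ae ?_
    filter_upwards [ae_powerMeasure] with r hr
    have := hr.1
    gcongr
  refine fun h => ?_
  rw [h, nonpos_iff_eq_zero, mul_eq_zero] at hle
  exact hle.elim (by simp [h0.ne']) (powerMeasure_univ_ne_zero h0 h01)

/-- For `α < 3` the second moment stays finite when the lower cut-off is removed. -/
lemma secondMoment_zero_ne_top (hα : α < 3) (hr₁ : r₁ ≠ ∞) : secondMoment α 0 r₁ ≠ ∞ := by
  rw [secondMoment, lintegral_powerMeasure (by fun_prop)]
  have h1 : IntegrableOn (fun r : ℝ => r ^ (2 - α)) (Set.Ioc 0 r₁.toReal) := by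
    rw [← intervalIntegrable_iff_integrableOn_Ioc_of_le ENNReal.toReal_nonneg]
    exact intervalIntegral.intervalIntegrable_rpow' (by linarith)
  have hset : {r : ℝ | 0 ≤ r ∧ ENNReal.ofReal r ≤ r₁} = Set.Icc 0 r₁.toReal := by
    ext r
    exact and_congr_right fun _ => ENNReal.ofReal_le_iff_le_toReal hr₁
  rw [hset, setLIntegral_congr Ioc_ae_eq_Icc.symm]
  refine ne_of_lt (lt_of_eq_of_lt (setLIntegral_congr_fun measurableSet_Ioc fun r hr => ?_)
    h1.lintegral_lt_top)
  have hr0 : 0 < r := hr.1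
  rw [← ENNReal.ofReal_mul (by positivity), ← Real.rpow_natCast, ← Real.rpow_add hr0]
  congr 2
  push_cast
  ring

/-- For `α ≥ 3` the integrand of the second moment is at least `1 / r` near the origin. -/
lemma log_le_secondMoment (hα : 3 ≤ α) {s : ℝ} (h0 : 0 < r₀) (hs : r₀ ≤ s) (hs1 : s ≤ 1)
    (hsr : ENNReal.ofReal s ≤ r₁) :
    ENNReal.ofReal (Real.log (s / r₀)) ≤ secondMoment α r₀ r₁ := by
  have hs0 : 0 < s := h0.trans_le hs
  have hi : IntervalIntegrable (fun r : ℝ => r⁻¹) volume r₀ s := by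
    refine intervalIntegral.intervalIntegrable_inv (fun r hr => ?_) continuousOn_id
    rw [Set.uIcc_of_le hs] at hr
    exact (h0.trans_le hr.1).ne'
  rw [← integral_inv_of_pos h0 hs0, intervalIntegral.integral_of_le hs,
    ofReal_integral_eq_lintegral_ofReal
      ((intervalIntegrable_iff_integrableOn_Ioc_of_le hs).1 hi),
    secondMoment, lintegral_powerMeasure (by fun_prop)]
  · refine (setLIntegral_mono' measurableSet_Ioc fun r hr => ?_).trans
      (lintegral_mono_set fun r hr => ⟨hr.1.le, (ENNReal.ofReal_le_ofReal hr.2).trans hsr⟩)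
    have hr0 : 0 < r := h0.trans hr.1
    rw [← ENNReal.ofReal_mul (by positivity), ← Real.rpow_natCast, ← Real.rpow_add hr0,
      ← Real.rpow_neg_one]
    refine ENNReal.ofReal_le_ofReal ?_
    refine Real.rpow_le_rpow_of_exponent_ge hr0 (hr.2.trans hs1) ?_
    push_cast
    linarith
  · filter_upwards [ae_restrict_mem measurableSet_Ioc] with r hr
    exact inv_nonneg.2 (h0.trans hr.1).le

lemma tendsto_secondMoment_top (hα : 3 ≤ α) (hr₁ : 0 < r₁) :
    Tendsto (fun r => secondMoment α r r₁) (𝓝[>] 0) (𝓝 ∞) := by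
  obtain ⟨s, hs0, hs, hs1⟩ := ENNReal.lt_iff_exists_real_btwn.1 (lt_min hr₁ one_pos)
  have hs' : 0 < s := ENNReal.ofReal_pos.1 hs
  have hlog : Tendsto (fun r => ENNReal.ofReal (Real.log (s / r))) (𝓝[>] 0) (𝓝 ∞) := by
    refine ENNReal.tendsto_ofReal_atTop.comp (Real.tendsto_log_atTop.comp ?_)
    exact (tendsto_inv_nhdsGT_zero.const_mul_atTop hs').congr fun r => (div_eq_mul_inv s r).symm
  refine tendsto_nhds_top_mono hlog ?_
  filter_upwards [Ioc_mem_nhdsGT hs'] with r hr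
  exact log_le_secondMoment hα hr.1 hr.2
    (by simpa using (hs1.trans_le (min_le_right _ _)).le) (hs1.trans_le (min_le_left _ _)).le

end

/-! ### The intensity of the marks -/

/-- The intensity per unit time of the marks, up to the constant factor that normalizes the law of
the sizes. -/
noncomputable def markMeasure (α r₀ : ℝ) (r₁ : ℝ≥0∞) (Q : Measure (Closeds Plane)) :
    Measure (Plane × ℝ × Closeds Plane) :=
  (volume : Measure Plane).prod ((powerMeasure α r₀ r₁).prod Q)

section

variable {α r₀ : ℝ} {r₁ : ℝ≥0∞} {Q : Measure (Closeds Plane)}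

lemma ae_size_shape {p : Closeds Plane → Prop} (hp : ∀ᵐ Y ∂Q, p Y) :
    ∀ᵐ w ∂(powerMeasure α r₀ r₁).prod Q, r₀ ≤ w.1 ∧ p w.2 :=
  ((Measure.quasiMeasurePreserving_fst.ae ae_powerMeasure).mono fun _ h => h.1).and
    (Measure.quasiMeasurePreserving_snd.ae hp)

lemma ae_markMeasure {p : ℝ × Closeds Plane → Prop}
    (hp : ∀ᵐ w ∂(powerMeasure α r₀ r₁).prod Q, p w) :
    ∀ᵐ m ∂markMeasure α r₀ r₁ Q, p m.2 :=
  Measure.quasiMeasurePreserving_snd.ae hp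

variable [IsProbabilityMeasure Q]

lemma markMeasure_apply {S : Set (Plane × ℝ × Closeds Plane)} (hS : MeasurableSet S) :
    markMeasure α r₀ r₁ Q S =
      ∫⁻ w, volume {p : Plane | (p, w) ∈ S} ∂(powerMeasure α r₀ r₁).prod Q :=
  Measure.prod_apply_symm hS

lemma markMeasure_mono {s : ℝ} (h : s ≤ r₀) : markMeasure α r₀ r₁ Q ≤ markMeasure α s r₁ Q :=
  Measure.prod_mono le_rfl (Measure.prod_mono (powerMeasure_mono h) le_rfl)

lemma leafIntensity_time_mark {J : Set ℝ} (hJ : MeasurableSet J)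
    {S : Set (Plane × ℝ × Closeds Plane)} (hS : MeasurableSet S) :
    leafIntensity α r₀ r₁ Q {z | z.time ∈ J ∧ z.mark ∈ S} =
      volume J * ((powerMeasure α r₀ r₁ Set.univ)⁻¹ * markMeasure α r₀ r₁ Q S) := by
  have hB : MeasurableSet {z : Leaf | z.time ∈ J ∧ z.mark ∈ S} :=
    (measurable_time hJ).inter (measurable_mark hS)
  have hlaw : sizeLaw α r₀ r₁ = (powerMeasure α r₀ r₁ Set.univ)⁻¹ • powerMeasure α r₀ r₁ := rfl
  rw [leafIntensity, hlaw, Measure.prod_smul_left, Measure.prod_apply_symm hB,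
    markMeasure_apply hS]
  have hsec : ∀ q : ℝ × ℝ × Closeds Plane,
      volume ((fun p : Plane => ((p, q) : Leaf)) ⁻¹' {z : Leaf | z.time ∈ J ∧ z.mark ∈ S}) =
        J.indicator 1 q.1 * volume {p : Plane | (p, q.2) ∈ S} := by
    intro q
    by_cases hq : q.1 ∈ J <;> simp [hq, Leaf.time, Leaf.mark]
  simp only [hsec]
  rw [lintegral_prod_mul (f := J.indicator (1 : ℝ → ℝ≥0∞))
      (g := fun w : ℝ × Closeds Plane => volume {p : Plane | (p, w) ∈ S})
      (by fun_prop (disch := assumption)) (measurable_measure_prodMk_right hS).aemeasurable,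
    lintegral_indicator_one hJ, lintegral_smul_measure, smul_eq_mul]

lemma ae_leafIntensity_of_ae {p : Plane × ℝ × Closeds Plane → Prop}
    (hp : ∀ᵐ m ∂markMeasure α r₀ r₁ Q, p m) :
    ∀ᵐ z ∂leafIntensity α r₀ r₁ Q, p z.mark := by
  have h0 := (measure_toMeasurable {m | ¬ p m}).trans (ae_iff.1 hp)
  have h1 := leafIntensity_time_mark (α := α) (r₀ := r₀) (r₁ := r₁) (Q := Q) MeasurableSet.univ
    (measurableSet_toMeasurable (markMeasure α r₀ r₁ Q) {m | ¬ p m})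
  rw [h0, mul_zero, mul_zero] at h1
  refine measure_mono_null (fun z hz => ?_) h1
  exact ⟨trivial, subset_toMeasurable _ _ hz⟩

lemma ae_notMem_frontier (x : Plane) (h0 : 0 < r₀)
    (hfr : ∀ᵐ Y : Closeds Plane ∂Q, volume (frontier (Y : Set Plane)) = 0) :
    ∀ᵐ m ∂markMeasure α r₀ r₁ Q, m.2.1⁻¹ • (x - m.1) ∉ frontier (m.2.2 : Set Plane) := by
  rw [ae_iff]
  simp only [not_not]
  have hm : MeasurableSet {m : Plane × ℝ × Closeds Plane |
      m.2.1⁻¹ • (x - m.1) ∈ frontier (m.2.2 : Set Plane)} :=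
    measurable_rescaled x measurableSet_mem_frontier
  rw [markMeasure_apply hm]
  refine (lintegral_eq_zero_iff (measurable_measure_prodMk_right hm)).2 ?_
  filter_upwards [ae_size_shape hfr] with w hw
  have := volume_rescaled_preimage x (h0.trans_le hw.1)
    (isClosed_frontier (s := (w.2 : Set Plane))).measurableSet
  rw [hw.2, mul_zero] at this
  exact this

lemma lintegral_sq_size (C : ℝ≥0∞) :
    ∫⁻ w, ENNReal.ofReal (w.1 ^ 2) * C ∂(powerMeasure α r₀ r₁).prod Q =
      secondMoment α r₀ r₁ * C := by
  rw [lintegral_prod_mul (f := fun r : ℝ => ENNReal.ofReal (r ^ 2)) (g := fun _ => C)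
    (by fun_prop) (by fun_prop), secondMoment]
  simp

/-- A set of marks whose positions lie, for each size `r`, in a disk of radius `r b`, has intensity
at most the area of that disk. -/
lemma markMeasure_le {S : Set (Plane × ℝ × Closeds Plane)} (hS : MeasurableSet S) (x : Plane)
    {b : ℝ} (h0 : 0 ≤ r₀) (hb : 0 ≤ b)
    (hSb : ∀ᵐ w ∂(powerMeasure α r₀ r₁).prod Q, ∀ p, (p, w) ∈ S → dist p x ≤ w.1 * b) :
    markMeasure α r₀ r₁ Q S ≤
      secondMoment α r₀ r₁ * volume (Metric.closedBall (0 : Plane) b) := by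
  rw [markMeasure_apply hS, ← lintegral_sq_size (Q := Q)]
  refine lintegral_mono_ae ?_
  filter_upwards [hSb, ae_size_shape (p := fun _ => True) (Q := Q)
    (Eventually.of_forall fun _ => trivial)] with w hw hr
  refine (measure_mono (t := Metric.closedBall x (w.1 * b)) fun p hp => hw p hp).trans ?_
  rw [Measure.addHaar_closedBall_mul _ _ (h0.trans hr.1) hb]
  simp

lemma Covers.dist_le {x : Plane} {m : Plane × ℝ × Closeds Plane} {a : ℝ} (h : Covers x m)
    (ha : (m.2.2 : Set Plane) ⊆ Metric.closedBall 0 a) : dist x m.1 ≤ m.2.1 * a := by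
  have h1 := ha h.2
  rw [mem_closedBall_zero_iff, norm_smul, Real.norm_eq_abs, abs_of_pos (inv_pos.2 h.1),
    ← dist_eq_norm, inv_mul_le_iff₀ h.1] at h1
  exact h1

lemma le_markMeasure_covers (x : Plane) {a : ℝ} (h0 : 0 < r₀)
    (ha : ∀ᵐ Y : Closeds Plane ∂Q, Metric.closedBall 0 a ⊆ (Y : Set Plane)) :
    secondMoment α r₀ r₁ * volume (Metric.closedBall (0 : Plane) a) ≤
      markMeasure α r₀ r₁ Q {m | Covers x m} := by
  rw [markMeasure_apply (measurableSet_covers x), ← lintegral_sq_size (Q := Q)]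
  refine lintegral_mono_ae ?_
  filter_upwards [ae_size_shape ha] with w hw
  refine le_of_le_of_eq ?_ (volume_covers x (h0.trans_le hw.1)).symm
  gcongr
  exact hw.2

lemma markMeasure_covers_le (x : Plane) {a : ℝ} (h0 : 0 ≤ r₀) (ha0 : 0 ≤ a)
    (ha : ∀ᵐ Y : Closeds Plane ∂Q, (Y : Set Plane) ⊆ Metric.closedBall 0 a) :
    markMeasure α r₀ r₁ Q {m | Covers x m} ≤
      secondMoment α r₀ r₁ * volume (Metric.closedBall (0 : Plane) a) := by
  refine markMeasure_le (measurableSet_covers x) x h0 ha0 ?_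
  filter_upwards [ae_size_shape ha] with w hw p hp
  have hc : Covers x (p, w) := hp
  rw [dist_comm]
  exact hc.dist_le hw.2

/-- A leaf that covers two points at distance `d` has size at least `d / (2 a)`, so that the
intensity of such leaves stays bounded as the lower cut-off is removed. -/
lemma markMeasure_covers_both_le (x y : Plane) {a : ℝ} (ha0 : 0 < a)
    (ha : ∀ᵐ Y : Closeds Plane ∂Q, (Y : Set Plane) ⊆ Metric.closedBall 0 a) :
    markMeasure α r₀ r₁ Q {m | Covers x m ∧ Covers y m} ≤
      secondMoment α (dist x y / (2 * a)) r₁ * volume (Metric.closedBall (0 : Plane) a) := by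
  have hS : MeasurableSet {m | Covers x m ∧ Covers y m} :=
    (measurableSet_covers x).inter (measurableSet_covers y)
  set d := dist x y / (2 * a) with hd
  have hd0 : 0 ≤ d := by positivity
  refine le_trans ?_ (markMeasure_covers_le (r₀ := d) (Q := Q) x hd0 ha0.le ha)
  rw [markMeasure_apply hS, markMeasure_apply (measurableSet_covers x)]
  have hm : MeasurableSet {r : ℝ | d ≤ r} := measurableSet_le measurable_const measurable_id
  have hle : (powerMeasure α r₀ r₁).restrict {r | d ≤ r} ≤ powerMeasure α d r₁ := by
    rw [powerMeasure, restrict_withDensity hm, Measure.restrict_restrict hm]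
    refine Measure.le_iff.2 fun A hA => ?_
    rw [powerMeasure, withDensity_apply _ hA, withDensity_apply _ hA]
    refine lintegral_mono' (Measure.restrict_mono_measure (Measure.restrict_mono ?_ le_rfl) A) le_rfl
    exact fun r hr => ⟨hr.1, hr.2.2⟩
  have hm' : MeasurableSet {w : ℝ × Closeds Plane | d ≤ w.1} :=
    measurableSet_le measurable_const measurable_fst
  have hprod : ((powerMeasure α r₀ r₁).prod Q).restrict {w | d ≤ w.1} ≤
      (powerMeasure α d r₁).prod Q := by
    have : {w : ℝ × Closeds Plane | d ≤ w.1} = {r | d ≤ r} ×ˢ Set.univ := by ext; simp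
    rw [this, ← Measure.prod_restrict, Measure.restrict_univ]
    exact Measure.prod_mono hle le_rfl
  refine le_trans ?_ (lintegral_mono' hprod le_rfl)
  rw [← lintegral_indicator hm']
  refine lintegral_mono_ae ?_
  filter_upwards [ae_size_shape (r₀ := r₀) ha] with w hw
  by_cases hwd : d ≤ w.1
  · rw [Set.indicator_of_mem (by exact hwd)]
    exact measure_mono fun p hp => hp.1
  · rw [Set.indicator_of_notMem (by exact hwd), nonpos_iff_eq_zero]
    convert measure_empty (μ := (volume : Measure Plane))
    refine Set.eq_empty_iff_forall_notMem.2 fun p hp => hwd ?_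
    have h1 := Covers.dist_le hp.1 hw.2
    have h2 := Covers.dist_le hp.2 hw.2
    rw [hd, div_le_iff₀ (by positivity)]
    have := dist_triangle_right x y p
    simp only at h1 h2
    linarith

/-- The measure of the marks that cover exactly one of `x` and `y` is continuous at `y = x`, because
the boundaries of the shapes are null sets. -/
lemma tendsto_markMeasure_covers_one (x : Plane) (hα : α < 3) (hr₁ : r₁ ≠ ∞) {a : ℝ}
    (ha : ∀ᵐ Y : Closeds Plane ∂Q, (Y : Set Plane) ⊆ Metric.closedBall 0 a)
    (hfr : ∀ᵐ Y : Closeds Plane ∂Q, volume (frontier (Y : Set Plane)) = 0) :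
    Tendsto (fun y => markMeasure α 0 r₁ Q {m | ¬ (Covers x m ↔ Covers y m)}) (𝓝 x) (𝓝 0) := by
  have hS : ∀ y, MeasurableSet {m | ¬ (Covers x m ↔ Covers y m)} := fun y =>
    ((measurableSet_covers x).iff (measurableSet_covers y)).compl
  have hpos : ∀ᵐ w ∂(powerMeasure α 0 r₁).prod Q, 0 < w.1 := by
    refine Measure.quasiMeasurePreserving_fst.ae ?_
    have h1 : ∀ᵐ r ∂powerMeasure α 0 r₁, r ≠ 0 := by
      refine (withDensity_absolutelyContinuous _ _).ae_le (ae_restrict_of_ae ?_)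
      exact Measure.ae_ne volume 0
    filter_upwards [h1, ae_powerMeasure] with r hr hr' using lt_of_le_of_ne hr'.1 hr.symm
  simp_rw [fun y => markMeasure_apply (α := α) (r₀ := 0) (r₁ := r₁) (Q := Q) (hS y)]
  rw [← lintegral_zero (μ := (powerMeasure α 0 r₁).prod Q)]
  refine tendsto_lintegral_filter_of_dominated_convergence
    (fun w => ENNReal.ofReal (w.1 ^ 2) * (2 * volume (Metric.closedBall (0 : Plane) a)))
    (Eventually.of_forall fun y => measurable_measure_prodMk_right (hS y))
    (Eventually.of_forall fun y => ?_) ?_ ?_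
  · filter_upwards [hpos, ae_size_shape ha] with w hw hw2
    refine (measure_mono (t := {p | Covers x (p, w)} ∪ {p | Covers y (p, w)})
      fun p hp => ?_).trans ((measure_union_le _ _).trans ?_)
    · by_contra hcon
      simp only [Set.mem_union, Set.mem_ofPred_eq, not_or] at hcon
      exact hp (iff_of_false hcon.1 hcon.2)
    · rw [volume_covers x hw, volume_covers y hw, ← two_mul, mul_left_comm]
      gcongr
      exact hw2.2
  · rw [lintegral_sq_size]
    exact ENNReal.mul_ne_top (secondMoment_zero_ne_top hα hr₁)
      (ENNReal.mul_ne_top (by simp) (measure_closedBall_lt_top).ne)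
  · filter_upwards [hpos, ae_size_shape (ha.and hfr)] with w hw hw2
    have hlim := tendsto_measure_of_ae_tendsto_indicator (μ := (volume : Measure Plane)) (𝓝 x)
      (A := ∅) (As := fun y => {p | ¬ (Covers x (p, w) ↔ Covers y (p, w))})
      (B := Metric.closedBall x (w.1 * a + 1)) MeasurableSet.empty
      (fun y => measurable_prodMk_right (hS y)) measurableSet_closedBall
      measure_closedBall_lt_top.ne ?_ ?_
    · simpa using hlim
    · filter_upwards [Metric.closedBall_mem_nhds x one_pos] with y hy p hp
      rw [Metric.mem_closedBall, dist_comm]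
      by_contra hcon
      refine hp (iff_of_false (fun h => ?_) (fun h => ?_))
      · have := h.dist_le hw2.2.1
        simp only at this
        linarith
      · have h1 := h.dist_le hw2.2.1
        have h2 := dist_triangle x y p
        rw [Metric.mem_closedBall, dist_comm] at hy
        simp only at h1
        linarith
    · have hnull := volume_rescaled_preimage x hw
        (isClosed_frontier (s := (w.2 : Set Plane))).measurableSet
      rw [hw2.2.2, mul_zero] at hnull
      have hae : ∀ᵐ p : Plane, w.1⁻¹ • (x - p) ∉ frontier (w.2 : Set Plane) := by
        rw [ae_iff]
        simpa using hnull
      filter_upwards [hae] with p hp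
      have hcont : Continuous fun y : Plane => w.1⁻¹ • (y - p) := by fun_prop
      simp only [Set.mem_empty_iff_false, iff_false, not_not]
      by_cases hx : w.1⁻¹ • (x - p) ∈ w.2
      · have hint : w.1⁻¹ • (x - p) ∈ interior (w.2 : Set Plane) := by
          by_contra hx'
          exact hp (by rw [w.2.isClosed.frontier_eq]; exact ⟨hx, hx'⟩)
        filter_upwards [hcont.continuousAt.preimage_mem_nhds
          (isOpen_interior.mem_nhds hint)] with y hy
        exact iff_of_true ⟨hw, hx⟩ ⟨hw, interior_subset (s := (w.2 : Set Plane)) hy⟩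
      · filter_upwards [hcont.continuousAt.preimage_mem_nhds
          (w.2.isClosed.isOpen_compl.mem_nhds hx)] with y hy
        exact iff_of_false (fun h => hx h.2) (fun h => hy h.2)

end

/-! ### Comparing the leaves visible at two points -/

section Deterministic

variable {z : ℕ → Leaf} {x y : Plane} {T : ℝ}

lemma IsTop.time_gt {i j : ℕ} (hi : IsTop z x i) (hj : (z j).time ∈ Set.Ioo (-T) 0)
    (hc : Covers x (z j).mark) : -T < (z i).time :=
  hj.1.trans_le (not_lt.1 fun h => hi.2.2 j h hj.2 hc)

lemma topIndex_ne (hx : RegularAt z x) (hy : RegularAt z y)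
    (hcov : ∃ i, (z i).time ∈ Set.Ioo (-T) 0 ∧ Covers x (z i).mark)
    (h : ∀ i, (z i).time ∈ Set.Ioo (-T) 0 → ¬ (Covers x (z i).mark ∧ Covers y (z i).mark)) :
    topIndex x z ≠ topIndex y z := by
  intro heq
  have h1 := isTop_topIndex hx.exists_isTop
  have h2 := isTop_topIndex hy.exists_isTop
  rw [← heq] at h2
  -- The common top leaf falls in the window and covers both points.
  obtain ⟨j, hj, hc⟩ := hcov
  exact h _ ⟨h1.time_gt hj hc, h1.1⟩ ⟨h1.2.1, h2.2.1⟩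

lemma IsTop.of_covers_iff {i : ℕ} (hi : IsTop z x i)
    (hcov : ∃ i, (z i).time ∈ Set.Ioo (-T) 0 ∧ Covers x (z i).mark)
    (h : ∀ i, (z i).time ∈ Set.Ioo (-T) 0 → (Covers x (z i).mark ↔ Covers y (z i).mark)) :
    IsTop z y i := by
  obtain ⟨j, hj, hc⟩ := hcov
  have ht := hi.time_gt hj hc
  exact ⟨hi.1, (h i ⟨ht, hi.1⟩).1 hi.2.1, fun k hk hk0 hck =>
    hi.2.2 k hk hk0 ((h k ⟨ht.trans hk, hk0⟩).2 hck)⟩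

lemma topIndex_eq
    (hcov : ∃ i, (z i).time ∈ Set.Ioo (-T) 0 ∧ Covers x (z i).mark)
    (h : ∀ i, (z i).time ∈ Set.Ioo (-T) 0 → (Covers x (z i).mark ↔ Covers y (z i).mark)) :
    topIndex x z = topIndex y z := by
  refine topIndex_congr fun i => ⟨fun hi => hi.of_covers_iff hcov h, fun hi => ?_⟩
  exact hi.of_covers_iff (hcov.imp fun j hj => ⟨hj.1, (h j hj.1).1 hj.2⟩)
    fun j hj => (h j hj).symm

end Deterministic

/-- The assumptions on the parameters of the model and on the law of the shapes, for shapes between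
the disks of radii `a₁` and `a₂`. -/
structure Admissible (α : ℝ) (r₁ : ℝ≥0∞) (Q : Measure (Closeds Plane)) (a₁ a₂ : ℝ) : Prop where
  one_lt : 1 < α
  ne_top : α ≤ 3 → r₁ ≠ ∞
  pos_inner : 0 < a₁
  pos_outer : 0 < a₂
  inner : ∀ᵐ Y : Closeds Plane ∂Q, Metric.closedBall 0 a₁ ⊆ (Y : Set Plane)
  outer : ∀ᵐ Y : Closeds Plane ∂Q, (Y : Set Plane) ⊆ Metric.closedBall 0 a₂
  frontier_null : ∀ᵐ Y : Closeds Plane ∂Q, volume (frontier (Y : Set Plane)) = 0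

lemma tendsto_ofReal_exp_neg :
    Tendsto (fun K : ℝ => ENNReal.ofReal (Real.exp (-K))) atTop (𝓝 0) := by
  rw [← ENNReal.ofReal_zero]
  exact ENNReal.tendsto_ofReal (Real.tendsto_exp_neg_atTop_nhds_zero)

lemma eq_zero_of_le_exp {p : ℝ≥0∞}
    (h : ∀ K : ℝ, 0 < K → p ≤ ENNReal.ofReal (Real.exp (-K))) : p = 0 := by
  refine nonpos_iff_eq_zero.1 (ge_of_tendsto tendsto_ofReal_exp_neg ?_)
  filter_upwards [eventually_gt_atTop 0] with K hK using h K hK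

lemma Admissible.volume_ball_ne_zero {α a₁ a₂ : ℝ} {r₁ : ℝ≥0∞} {Q : Measure (Closeds Plane)}
    (hA : Admissible α r₁ Q a₁ a₂) : volume (Metric.closedBall (0 : Plane) a₁) ≠ 0 :=
  (Metric.measure_closedBall_pos _ _ hA.pos_inner).ne'

section Model

variable {α r₀ a₁ a₂ : ℝ} {r₁ : ℝ≥0∞} {Q : Measure (Closeds Plane)} [IsProbabilityMeasure Q]
  {Ω : Type*} [MeasurableSpace Ω] {P : Measure Ω} [IsProbabilityMeasure P] {Φ : ℕ → Ω → Leaf}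

lemma Admissible.covers_ne_zero (hA : Admissible α r₁ Q a₁ a₂) (h0 : 0 < r₀)
    (h01 : ENNReal.ofReal r₀ < r₁) (x : Plane) :
    markMeasure α r₀ r₁ Q {m | Covers x m} ≠ 0 := by
  intro h
  have := le_markMeasure_covers (α := α) (r₁ := r₁) x h0 hA.inner
  rw [h, nonpos_iff_eq_zero, mul_eq_zero] at this
  exact this.elim (secondMoment_ne_zero h0 h01) hA.volume_ball_ne_zero

lemma Admissible.covers_ne_top (hA : Admissible α r₁ Q a₁ a₂) (h0 : 0 < r₀) (x : Plane) :
    markMeasure α r₀ r₁ Q {m | Covers x m} ≠ ∞ :=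
  ne_top_of_le_ne_top (ENNReal.mul_ne_top (secondMoment_ne_top hA.one_lt hA.ne_top h0)
    measure_closedBall_lt_top.ne) (markMeasure_covers_le x h0.le hA.pos_outer.le hA.outer)

/-- In the time window in which `x` is covered `K` times on average, the probability that a leaf
with mark in `A` falls or that `x` stays uncovered is small if `A` has small relative intensity. -/
lemma Admissible.exists_time_window (hA : Admissible α r₁ Q a₁ a₂) (h0 : 0 < r₀)
    (h01 : ENNReal.ofReal r₀ < r₁)
    (hΦ : IsPoissonProcess Φ (leafIntensity α r₀ r₁ Q) P) (x : Plane)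
    {A : Set (Plane × ℝ × Closeds Plane)} (hAm : MeasurableSet A) {K : ℝ} (hK : 0 < K) :
    ∃ T : ℝ, P {ω | (∃ i, (Φ i ω).time ∈ Set.Ioo (-T) 0 ∧ (Φ i ω).mark ∈ A) ∨
        ¬ ∃ i, (Φ i ω).time ∈ Set.Ioo (-T) 0 ∧ Covers x (Φ i ω).mark} ≤
      ENNReal.ofReal K * (markMeasure α r₀ r₁ Q A / markMeasure α r₀ r₁ Q {m | Covers x m}) +
        ENNReal.ofReal (Real.exp (-K)) := by
  set c := (powerMeasure α r₀ r₁ Set.univ)⁻¹ with hc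
  set l := markMeasure α r₀ r₁ Q {m | Covers x m} with hl
  have hc0 : c ≠ 0 := ENNReal.inv_ne_zero.2 (powerMeasure_univ_lt_top hA.one_lt h0).ne
  have hct : c ≠ ∞ := ENNReal.inv_ne_top.2 (powerMeasure_univ_ne_zero h0 h01)
  have hcl0 : c * l ≠ 0 := mul_ne_zero hc0 (hA.covers_ne_zero h0 h01 x)
  have hclt : c * l ≠ ∞ := ENNReal.mul_ne_top hct (hA.covers_ne_top h0 x)
  have hpos : 0 < (c * l).toReal := ENNReal.toReal_pos hcl0 hclt
  -- Leaves covering `x` fall at the rate `c * l`, so that `K` of them are expected in this time.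
  set T := K / (c * l).toReal with hT
  have hvol : volume (Set.Ioo (-T) 0) = ENNReal.ofReal K / (c * l) := by
    rw [Real.volume_Ioo, zero_sub, neg_neg, hT, ENNReal.ofReal_div_of_pos hpos,
      ENNReal.ofReal_toReal hclt]
  have hm : ∀ {S : Set (Plane × ℝ × Closeds Plane)}, MeasurableSet S →
      MeasurableSet {z : Leaf | z.time ∈ Set.Ioo (-T) 0 ∧ z.mark ∈ S} := fun hS =>
    (measurable_time measurableSet_Ioo).inter (measurable_mark hS)
  have hC : leafIntensity α r₀ r₁ Q {z | z.time ∈ Set.Ioo (-T) 0 ∧ z.mark ∈ {m | Covers x m}} =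
      ENNReal.ofReal K := by
    rw [leafIntensity_time_mark measurableSet_Ioo (measurableSet_covers x), hvol,
      ENNReal.div_mul_cancel hcl0 hclt]
  refine ⟨T, ?_⟩
  rw [Set.ofPred_or]
  refine (measure_union_le _ _).trans (add_le_add ?_ (le_of_eq ?_))
  · refine (hΦ.measure_exists_mem_le (hm hAm)).trans (le_of_eq ?_)
    rw [leafIntensity_time_mark measurableSet_Ioo hAm, hvol, ← hc,
      ← ENNReal.mul_div_mul_left _ l hc0 hct]
    simp only [div_eq_mul_inv]
    ring
  · have := hΦ.measure_forall_notMem (hm (measurableSet_covers x)) (by rw [hC]; simp)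
    rw [hC, ENNReal.toReal_ofReal hK.le] at this
    rw [← this]
    congr 1
    ext ω
    simp

lemma Admissible.ae_exists_covers (hA : Admissible α r₁ Q a₁ a₂) (h0 : 0 < r₀)
    (h01 : ENNReal.ofReal r₀ < r₁)
    (hΦ : IsPoissonProcess Φ (leafIntensity α r₀ r₁ Q) P) (x : Plane) :
    ∀ᵐ ω ∂P, ∃ i, (Φ i ω).time < 0 ∧ Covers x (Φ i ω).mark := by
  refine eq_zero_of_le_exp fun K hK => ?_
  obtain ⟨T, hT⟩ := hA.exists_time_window h0 h01 hΦ x MeasurableSet.empty hK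
  rw [measure_empty, ENNReal.zero_div, mul_zero, zero_add] at hT
  refine (measure_mono fun ω hω => ?_).trans hT
  exact Or.inr fun ⟨i, hi, hci⟩ => hω ⟨i, hi.2, hci⟩

lemma Admissible.ae_finite_hitting (hA : Admissible α r₁ Q a₁ a₂) (h0 : 0 < r₀)
    (h01 : ENNReal.ofReal r₀ < r₁)
    (hΦ : IsPoissonProcess Φ (leafIntensity α r₀ r₁ Q) P) (x : Plane) (T : ℝ) :
    ∀ᵐ ω ∂P, {i | (Φ i ω).time ∈ Set.Ioo (-T) 0 ∧
      ((Φ i ω).toSet ∩ Metric.closedBall x 1).Nonempty}.Finite := by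
  set S : Set (Plane × ℝ × Closeds Plane) := {m | dist m.1 x ≤ m.2.1 * a₂ + 1} with hS
  have hSm : MeasurableSet S := measurableSet_le (by fun_prop) (by fun_prop)
  -- As sizes are at least `r₀`, the radius `r a₂ + 1` is at most `r (a₂ + 1 / r₀)`.
  have hνS : markMeasure α r₀ r₁ Q S ≠ ∞ := by
    refine ne_top_of_le_ne_top (ENNReal.mul_ne_top (secondMoment_ne_top hA.one_lt hA.ne_top h0)
      measure_closedBall_lt_top.ne) (markMeasure_le hSm x (b := a₂ + 1 / r₀) h0.le
        (by have := hA.pos_outer; positivity) ?_)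
    filter_upwards [ae_size_shape (Q := Q) hA.outer] with w hw p hp
    refine le_trans (show dist p x ≤ w.1 * a₂ + 1 from hp) ?_
    rw [mul_add, mul_one_div]
    gcongr
    exact (one_le_div h0).2 hw.1
  have hsize : ∀ᵐ ω ∂P, ∀ i, r₀ ≤ (Φ i ω).mark.2.1 ∧
      ((Φ i ω).mark.2.2 : Set Plane) ⊆ Metric.closedBall 0 a₂ :=
    hΦ.ae_forall_of_ae (ae_leafIntensity_of_ae (ae_markMeasure (ae_size_shape hA.outer)))
  have hfin := hΦ.ae_finite ((measurable_time measurableSet_Ioo).inter (measurable_mark hSm))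
    (show leafIntensity α r₀ r₁ Q {z | z.time ∈ Set.Ioo (-T) 0 ∧ z.mark ∈ S} ≠ ∞ by
      rw [leafIntensity_time_mark measurableSet_Ioo hSm]
      exact ENNReal.mul_ne_top measure_Ioo_lt_top.ne (ENNReal.mul_ne_top
        (ENNReal.inv_ne_top.2 (powerMeasure_univ_ne_zero h0 h01)) hνS))
  filter_upwards [hsize, hfin] with ω hω hωfin
  refine hωfin.subset fun i hi => ⟨hi.1, ?_⟩
  obtain ⟨y, hy, hyx⟩ := hi.2
  have hc := ((mem_toSet_iff (h0.trans_le (hω i).1)).1 hy).dist_le (hω i).2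
  change dist (Φ i ω).mark.1 x ≤ (Φ i ω).mark.2.1 * a₂ + 1
  have h1 := dist_triangle_left (Φ i ω).mark.1 x y
  rw [Metric.mem_closedBall] at hyx
  linarith

/-- At a given point almost every configuration is regular. -/
lemma Admissible.ae_regularAt (hA : Admissible α r₁ Q a₁ a₂) (h0 : 0 < r₀)
    (h01 : ENNReal.ofReal r₀ < r₁)
    (hΦ : IsPoissonProcess Φ (leafIntensity α r₀ r₁ Q) P) (x : Plane) :
    ∀ᵐ ω ∂P, RegularAt (fun i => Φ i ω) x := by
  have hsize : ∀ᵐ ω ∂P, ∀ i, r₀ ≤ (Φ i ω).mark.2.1 ∧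
      ((Φ i ω).mark.2.2 : Set Plane) ⊆ Metric.closedBall 0 a₂ :=
    hΦ.ae_forall_of_ae (ae_leafIntensity_of_ae (ae_markMeasure (ae_size_shape hA.outer)))
  have hfr := hΦ.ae_forall_of_ae (ae_leafIntensity_of_ae
    (ae_notMem_frontier (α := α) (r₁ := r₁) x h0 hA.frontier_null))
  have hfin := ae_all_iff.2 fun T : ℕ => hA.ae_finite_hitting h0 h01 hΦ x (T : ℝ)
  filter_upwards [hsize, hfr, hfin, hA.ae_exists_covers h0 h01 hΦ x] with ω h1 h2 h3 h4
  have hpos : ∀ i, 0 < (Φ i ω).size := fun i => h0.trans_le (h1 i).1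
  exact ⟨hpos, fun i hi => h2 i ((mem_frontier_toSet_iff (hpos i)).1 hi), h3, h4⟩

lemma Admissible.measure_topIndex_eq_le (hA : Admissible α r₁ Q a₁ a₂) (h0 : 0 < r₀)
    (h01 : ENNReal.ofReal r₀ < r₁)
    (hΦ : IsPoissonProcess Φ (leafIntensity α r₀ r₁ Q) P) (x y : Plane) {K : ℝ} (hK : 0 < K) :
    P {ω | topIndex x (fun i => Φ i ω) = topIndex y (fun i => Φ i ω)} ≤
      ENNReal.ofReal K * (markMeasure α r₀ r₁ Q {m | Covers x m ∧ Covers y m} /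
        markMeasure α r₀ r₁ Q {m | Covers x m}) + ENNReal.ofReal (Real.exp (-K)) := by
  obtain ⟨T, hT⟩ := hA.exists_time_window h0 h01 hΦ x
    ((measurableSet_covers x).inter (measurableSet_covers y)) hK
  refine (measure_mono_ae ?_).trans hT
  filter_upwards [hA.ae_regularAt h0 h01 hΦ x, hA.ae_regularAt h0 h01 hΦ y] with ω hx hy hω
  by_contra hcon
  have hcon' := not_or.1 hcon
  exact topIndex_ne hx hy (not_not.1 hcon'.2) (fun i hi hc => hcon'.1 ⟨i, hi, hc⟩) hω

lemma Admissible.measure_topIndex_ne_le (hA : Admissible α r₁ Q a₁ a₂) (h0 : 0 < r₀)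
    (h01 : ENNReal.ofReal r₀ < r₁)
    (hΦ : IsPoissonProcess Φ (leafIntensity α r₀ r₁ Q) P) (x y : Plane) {K : ℝ} (hK : 0 < K) :
    P {ω | topIndex x (fun i => Φ i ω) ≠ topIndex y (fun i => Φ i ω)} ≤
      ENNReal.ofReal K * (markMeasure α r₀ r₁ Q {m | ¬ (Covers x m ↔ Covers y m)} /
        markMeasure α r₀ r₁ Q {m | Covers x m}) + ENNReal.ofReal (Real.exp (-K)) := by
  obtain ⟨T, hT⟩ := hA.exists_time_window h0 h01 hΦ x
    ((measurableSet_covers x).iff (measurableSet_covers y)).compl hK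
  refine (measure_mono fun ω hω => ?_).trans hT
  by_contra hcon
  have hcon' := not_or.1 hcon
  exact hω (topIndex_eq (not_not.1 hcon'.2)
    (fun i hi => not_not.1 fun hc => hcon'.1 ⟨i, hi, hc⟩))

lemma Admissible.coloredField_ae_eq (hA : Admissible α r₁ Q a₁ a₂) (h0 : 0 < r₀)
    (h01 : ENNReal.ofReal r₀ < r₁)
    (hΦ : IsPoissonProcess Φ (leafIntensity α r₀ r₁ Q) P) (U : ℕ → Ω → ℝ) (x : Plane) :
    coloredField Φ U x =ᵐ[P] fun ω => U (topIndex x fun i => Φ i ω) ω := by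
  filter_upwards [hA.ae_regularAt h0 h01 hΦ x] with ω hω
  exact hω.coloredImage_eq _

end Model

/-! ### The colors -/

instance : IsProbabilityMeasure uniformLaw := ⟨by simp [uniformLaw]⟩

section Colors

variable {α r₀ : ℝ} {r₁ : ℝ≥0∞} {Q : Measure (Closeds Plane)}
  {Ω : Type*} [MeasurableSpace Ω] {P : Measure Ω} [IsProbabilityMeasure P]
  {Φ : ℕ → Ω → Leaf} {U : ℕ → Ω → ℝ}

/-- If the leaves select `n` colors by means of the indices `N`, then on the event that these indices
are distinct the selected colors are independent and uniform. Hence their law dominates the product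
law up to the probability that two indices agree. -/
lemma IsUniformlyColoredDeadLeaves.pi_le (hM : IsUniformlyColoredDeadLeaves P α r₀ r₁ Q Φ U)
    {n : ℕ} {N : (ℕ → Leaf) → Fin n → ℕ} (hN : Measurable N) {B : Set (Fin n → ℝ)}
    (hB : MeasurableSet B) :
    Measure.pi (fun _ : Fin n => uniformLaw) B ≤
      P {ω | (fun k => U (N (fun i => Φ i ω) k) ω) ∈ B} +
        P {ω | ¬ (N fun i => Φ i ω).Injective} := by
  set L := Measure.pi (fun _ : Fin n => uniformLaw)
  have hΦ : Measurable fun ω i => Φ i ω := measurable_pi_lambda _ hM.leaves.measurable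
  set F : Ω → Fin n → ℕ := fun ω => N fun i => Φ i ω
  have hF : Measurable F := hN.comp hΦ
  have hUm : ∀ m : Fin n → ℕ, Measurable fun (u : ℕ → ℝ) (k : Fin n) => u (m k) := fun m => by
    fun_prop
  set inj : Set (Fin n → ℕ) := {m | m.Injective}
  have hinj : P (F ⁻¹' inj) * L B ≤ P {ω | (fun k => U (F ω k) ω) ∈ B} := by
    have h1 : ∀ m ∈ inj, P (F ⁻¹' {m} ∩ {ω | (fun k => U (m k) ω) ∈ B}) = P (F ⁻¹' {m}) * L B := by
      intro m hm
      have hlaw := (hM.color_iIndep.precomp hm).hasLaw_pi (fun k => hM.color_law (m k))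
      have h2 := hM.color_indep.measure_inter_preimage_eq_mul (N ⁻¹' {m})
        ((fun (u : ℕ → ℝ) (k : Fin n) => u (m k)) ⁻¹' B) (hN (measurableSet_singleton m))
        (hUm m hB)
      refine h2.trans ?_
      congr 1
      exact hlaw.measure_eq hB
    have h3 : F ⁻¹' inj = ⋃ m ∈ inj, F ⁻¹' {m} := by ext; simp
    have hd : inj.PairwiseDisjoint fun m => F ⁻¹' {m} := fun a _ b _ hab =>
      (Set.disjoint_singleton.2 hab).preimage F
    have hmU : ∀ m : Fin n → ℕ, MeasurableSet {ω | (fun k => U (m k) ω) ∈ B} := fun m =>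
      (measurable_pi_lambda _ fun k => hM.measurable_color (m k)) hB
    calc P (F ⁻¹' inj) * L B
        = ∑' m : inj, P (F ⁻¹' {(m : Fin n → ℕ)} ∩ {ω | (fun k => U (m.1 k) ω) ∈ B}) := by
          rw [h3, measure_biUnion inj.to_countable hd
            (fun m _ => hF (measurableSet_singleton m)), ← ENNReal.tsum_mul_right]
          exact tsum_congr fun m => (h1 m m.2).symm
      _ = P (⋃ m ∈ inj, F ⁻¹' {m} ∩ {ω | (fun k => U (m k) ω) ∈ B}) := by
          rw [measure_biUnion inj.to_countable (fun a ha b hb hab => (hd ha hb hab).mono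
            Set.inter_subset_left Set.inter_subset_left)
            (fun m _ => (hF (measurableSet_singleton m)).inter (hmU m))]
      _ ≤ P {ω | (fun k => U (F ω k) ω) ∈ B} := by
          refine measure_mono fun ω hω => ?_
          obtain ⟨m, -, hm, hmB⟩ := Set.mem_iUnion₂.1 hω
          have hm' : F ω = m := hm
          subst hm'
          exact hmB
  have hinjm : MeasurableSet (F ⁻¹' inj) := hF (Set.to_countable inj).measurableSet
  calc L B = (P (F ⁻¹' inj) + P (F ⁻¹' inj)ᶜ) * L B := by
        rw [measure_add_measure_compl hinjm, measure_univ, one_mul]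
    _ ≤ P {ω | (fun k => U (F ω k) ω) ∈ B} + P (F ⁻¹' inj)ᶜ := by
        rw [add_mul]
        exact add_le_add hinj (mul_le_of_le_one_right' prob_le_one)

end Colors

/-! ### Removing the lower cut-off -/

lemma tendsto_zero_of_le_exp {ι : Type*} {l : Filter ι} {f q : ι → ℝ≥0∞}
    (hq : Tendsto q l (𝓝 0))
    (h : ∀ K : ℝ, 0 < K →
      ∀ᶠ i in l, f i ≤ ENNReal.ofReal K * q i + ENNReal.ofReal (Real.exp (-K))) :
    Tendsto f l (𝓝 0) := by
  refine ENNReal.tendsto_nhds_zero.2 fun ε hε => ?_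
  have hε2 : 0 < ε / 2 := ENNReal.half_pos hε.ne'
  obtain ⟨K, hK1, hK2⟩ :=
    ((eventually_gt_atTop 0).and (ENNReal.tendsto_nhds_zero.1 tendsto_ofReal_exp_neg _ hε2)).exists
  have h2 : Tendsto (fun i => ENNReal.ofReal K * q i) l (𝓝 0) := by
    simpa using ENNReal.Tendsto.const_mul hq (Or.inr ENNReal.ofReal_ne_top)
  filter_upwards [h K hK1, ENNReal.tendsto_nhds_zero.1 h2 _ hε2] with i hi hi2
  exact hi.trans ((add_le_add hi2 hK2).trans_eq (ENNReal.add_halves ε))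

/-- The filter `r₀ → 0` on the admissible cut-offs. -/
abbrev cutoffFilter (r₁ : ℝ≥0∞) : Filter (Cutoff r₁) :=
  Filter.comap (fun r₀ : Cutoff r₁ => (r₀ : ℝ)) (𝓝 0)

lemma tendsto_cutoff (r₁ : ℝ≥0∞) :
    Tendsto (fun r₀ : Cutoff r₁ => (r₀ : ℝ)) (cutoffFilter r₁) (𝓝[>] 0) :=
  tendsto_nhdsWithin_iff.2 ⟨tendsto_comap, Eventually.of_forall fun r₀ => r₀.2.1⟩

lemma cutoffFilter_neBot {r₁ : ℝ≥0∞} (hr₁ : 0 < r₁) : (cutoffFilter r₁).NeBot := by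
  refine comap_neBot fun t ht => ?_
  obtain ⟨s, hs0, hs, hs1⟩ := ENNReal.lt_iff_exists_real_btwn.1 hr₁
  have hs' : 0 < s := ENNReal.ofReal_pos.1 hs
  have h1 : ∀ᶠ r in 𝓝[>] (0 : ℝ), r ∈ Set.Ioc 0 s := Ioc_mem_nhdsGT hs'
  have h2 : ∀ᶠ r in 𝓝[>] (0 : ℝ), r ∈ t := mem_nhdsWithin_of_mem_nhds ht
  obtain ⟨r, hr, hrt⟩ := (h1.and h2).exists
  exact ⟨⟨r, hr.1, (ENNReal.ofReal_le_ofReal hr.2).trans_lt hs1⟩, hrt⟩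

lemma isWhiteNoise_of_hasLaw_pi {Ω : Type*} [MeasurableSpace Ω] {P : Measure Ω}
    [IsProbabilityMeasure P] {Z : Plane → Ω → ℝ} {ρ : Measure ℝ} [IsProbabilityMeasure ρ]
    (h : ∀ (n : ℕ) (x : Fin n → Plane), x.Injective →
      HasLaw (fun ω k => Z (x k) ω) (Measure.pi fun _ => ρ) P) : IsWhiteNoise Z ρ P := by
  have hm : ∀ x, HasLaw (Z x) ρ P := fun x =>
    (measurePreserving_eval (fun _ : Fin 1 => ρ) 0).hasLaw.comp
      (h 1 (fun _ => x) (Function.injective_of_subsingleton _))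
  refine ⟨iIndepFun_iff_finset.2 fun s => ?_, hm⟩
  have hx := h s.card (fun k => (s.equivFin.symm k : Plane))
    (Subtype.val_injective.comp s.equivFin.symm.injective)
  have h1 := (iIndepFun_iff_hasLaw_pi_pi
    (X := fun k : Fin s.card => Z (s.equivFin.symm k : Plane)) fun k => hm _).2 hx
  exact (iIndepFun_precomp_of_bijective (f := s.restrict Z) s.equivFin.symm.bijective).1 h1

section Limit

variable {α a₁ a₂ : ℝ} {r₁ : ℝ≥0∞} {Q : Measure (Closeds Plane)} [IsProbabilityMeasure Q]
  {Ω : Cutoff r₁ → Type*} [∀ r₀, MeasurableSpace (Ω r₀)]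
  {P : ∀ r₀, Measure (Ω r₀)} [∀ r₀, IsProbabilityMeasure (P r₀)]
  {Φ : ∀ r₀, ℕ → Ω r₀ → Leaf} {U : ∀ r₀, ℕ → Ω r₀ → ℝ}
  {Ω' : Type*} [MeasurableSpace Ω'] {P' : Measure Ω'} [IsProbabilityMeasure P']
  {I : Plane → Ω' → ℝ}

/-- For `α ≥ 3` the small leaves that cover only one of two given points prevail. -/
lemma Admissible.tendsto_measure_topIndex_eq (hA : Admissible α r₁ Q a₁ a₂) (hr₁ : 0 < r₁)
    (hα : 3 ≤ α)
    (hΦ : ∀ r₀ : Cutoff r₁, IsPoissonProcess (Φ r₀) (leafIntensity α r₀ r₁ Q) (P r₀))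
    {x y : Plane} (hxy : x ≠ y) :
    Tendsto (fun r₀ => P r₀ {ω | topIndex x (fun i => Φ r₀ i ω) = topIndex y (fun i => Φ r₀ i ω)})
      (cutoffFilter r₁) (𝓝 0) := by
  have hd : 0 < dist x y / (2 * a₂) := div_pos (dist_pos.2 hxy) (by linarith [hA.pos_outer])
  set C := secondMoment α (dist x y / (2 * a₂)) r₁ * volume (Metric.closedBall (0 : Plane) a₂)
  have hC : C ≠ ∞ := ENNReal.mul_ne_top (secondMoment_ne_top hA.one_lt hA.ne_top hd)
    measure_closedBall_lt_top.ne
  have hden : Tendsto (fun r₀ : Cutoff r₁ =>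
      secondMoment α r₀ r₁ * volume (Metric.closedBall (0 : Plane) a₁)) (cutoffFilter r₁)
      (𝓝 ∞) := by
    have := ENNReal.Tendsto.mul_const (b := volume (Metric.closedBall (0 : Plane) a₁))
      ((tendsto_secondMoment_top hα hr₁).comp (tendsto_cutoff r₁)) (Or.inl ENNReal.top_ne_zero)
    rwa [ENNReal.top_mul hA.volume_ball_ne_zero] at this
  have hq := ENNReal.Tendsto.const_div (a := C) hden (Or.inr hC)
  rw [ENNReal.div_top] at hq
  refine tendsto_zero_of_le_exp hq fun K hK => Eventually.of_forall fun r₀ => ?_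
  refine (hA.measure_topIndex_eq_le r₀.2.1 r₀.2.2 (hΦ r₀) x y hK).trans ?_
  gcongr
  · exact markMeasure_covers_both_le x y hA.pos_outer hA.outer
  · exact le_markMeasure_covers x r₀.2.1 hA.inner

lemma Admissible.isWhiteNoise (hA : Admissible α r₁ Q a₁ a₂) (hr₁ : 0 < r₁) (hα : 3 ≤ α)
    (hmodel : ∀ r₀ : Cutoff r₁, IsUniformlyColoredDeadLeaves (P r₀) α r₀ r₁ Q (Φ r₀) (U r₀))
    (hI : TendstoFidi (fun r₀ => coloredField (Φ r₀) (U r₀)) (cutoffFilter r₁) I P P') :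
    IsWhiteNoise I uniformLaw P' := by
  -- The joint laws converge to the product law, which is therefore the law of the limit.
  refine isWhiteNoise_of_hasLaw_pi fun n x hx => ?_
  have := cutoffFilter_neBot hr₁
  set N : (ℕ → Leaf) → Fin n → ℕ := fun z k => topIndex (x k) z
  have hN : Measurable N := measurable_pi_lambda _ fun k => measurable_topIndex (x k)
  set q : Cutoff r₁ → ℝ≥0∞ := fun r₀ => P r₀ {ω | ¬ (N fun i => Φ r₀ i ω).Injective}
  have hq : Tendsto q (cutoffFilter r₁) (𝓝 0) := by
    have hsum : Tendsto (fun r₀ => ∑ p : Fin n × Fin n, if p.1 = p.2 then 0 else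
        P r₀ {ω | topIndex (x p.1) (fun i => Φ r₀ i ω) = topIndex (x p.2) (fun i => Φ r₀ i ω)})
        (cutoffFilter r₁) (𝓝 0) := by
      rw [show 𝓝 (0 : ℝ≥0∞) = 𝓝 (∑ _p : Fin n × Fin n, 0) by rw [Finset.sum_const_zero]]
      refine tendsto_finsetSum _ fun p _ => ?_
      split_ifs with hp
      · exact tendsto_const_nhds
      · exact hA.tendsto_measure_topIndex_eq hr₁ hα (fun r₀ => (hmodel r₀).leaves) (hx.ne hp)
    refine tendsto_of_tendsto_of_tendsto_of_le_of_le tendsto_const_nhds hsum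
      (fun _ => zero_le) fun r₀ => ?_
    refine (measure_mono (t := ⋃ p : Fin n × Fin n, if p.1 = p.2 then ∅ else
      {ω | topIndex (x p.1) (fun i => Φ r₀ i ω) = topIndex (x p.2) (fun i => Φ r₀ i ω)})
      fun ω hω => ?_).trans ((measure_iUnion_le _).trans_eq ?_)
    · simp only [Function.Injective, not_forall, Set.mem_ofPred_eq] at hω
      obtain ⟨k, l, hkl, hne⟩ := hω
      refine Set.mem_iUnion.2 ⟨(k, l), ?_⟩
      rw [if_neg hne]
      exact hkl
    · rw [tsum_fintype]
      refine Finset.sum_congr rfl fun p _ => ?_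
      split_ifs <;> simp
  have hfidi := hI n x
  have hlim : Tendsto (β := ProbabilityMeasure (Fin n → ℝ))
      (fun r₀ => ⟨(P r₀).map fun ω k => coloredField (Φ r₀) (U r₀) (x k) ω,
        Measure.isProbabilityMeasure_map (hfidi.forall_aemeasurable r₀)⟩) (cutoffFilter r₁)
      (𝓝 ⟨Measure.pi fun _ : Fin n => uniformLaw, inferInstance⟩) := by
    refine tendsto_of_forall_isOpen_le_liminf' fun G hG => ?_
    change Measure.pi (fun _ : Fin n => uniformLaw) G ≤ _
    refine le_of_forall_lt fun c hc => ?_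
    obtain ⟨c', hcc', hc'⟩ := exists_between hc
    refine hcc'.trans_le (le_liminf_of_le (by isBoundedDefault) ?_)
    filter_upwards [ENNReal.tendsto_nhds_zero.1 hq _ (tsub_pos_of_lt hc')] with r₀ hr₀
    have h1 := (hmodel r₀).pi_le hN hG.measurableSet
    have hfield : (fun ω k => coloredField (Φ r₀) (U r₀) (x k) ω) =ᵐ[P r₀]
        fun ω k => U r₀ (N (fun i => Φ r₀ i ω) k) ω := by
      filter_upwards [ae_all_iff.2 fun k : Fin n => hA.coloredField_ae_eq r₀.2.1 r₀.2.2
        (hmodel r₀).leaves (U r₀) (x k)] with ω hω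
      exact funext hω
    have h2 : ((P r₀).map fun ω k => coloredField (Φ r₀) (U r₀) (x k) ω) G =
        P r₀ {ω | (fun k => U r₀ (N (fun i => Φ r₀ i ω) k) ω) ∈ G} := by
      rw [Measure.map_apply_of_aemeasurable (hfidi.forall_aemeasurable r₀) hG.measurableSet]
      refine measure_congr ?_
      filter_upwards [hfield] with ω hω
      exact congrArg (· ∈ G) hω
    change c' ≤ ((P r₀).map fun ω k => coloredField (Φ r₀) (U r₀) (x k) ω) G
    rw [h2]
    have h3 : c' + (Measure.pi (fun _ : Fin n => uniformLaw) G - c') ≤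
        P r₀ {ω | (fun k => U r₀ (N (fun i => Φ r₀ i ω) k) ω) ∈ G} +
          (Measure.pi (fun _ : Fin n => uniformLaw) G - c') := by
      rw [add_tsub_cancel_of_le hc'.le]
      exact h1.trans (add_le_add le_rfl hr₀)
    exact (ENNReal.add_le_add_iff_right
      (ENNReal.sub_ne_top (measure_ne_top _ _))).1 h3
  exact ⟨hfidi.aemeasurable_limit,
    congrArg (fun ν : ProbabilityMeasure (Fin n → ℝ) => (ν : Measure (Fin n → ℝ)))
      (tendsto_nhds_unique hfidi.tendsto hlim)⟩

/-- For `α < 3` two close points are, uniformly in the cut-off, likely to lie in the same visible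
part. -/
lemma Admissible.stochasticallyContinuous (hA : Admissible α r₁ Q a₁ a₂) (hr₁ : 0 < r₁)
    (hα : α < 3)
    (hmodel : ∀ r₀ : Cutoff r₁, IsUniformlyColoredDeadLeaves (P r₀) α r₀ r₁ Q (Φ r₀) (U r₀))
    (hI : TendstoFidi (fun r₀ => coloredField (Φ r₀) (U r₀)) (cutoffFilter r₁) I P P') :
    StochasticallyContinuous I P' := by
  intro x ε hε
  have := cutoffFilter_neBot hr₁
  have hfin := hA.ne_top hα.le
  obtain ⟨s, hs0, hs, hs1⟩ := ENNReal.lt_iff_exists_real_btwn.1 hr₁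
  have hs' : 0 < s := ENNReal.ofReal_pos.1 hs
  set D := secondMoment α s r₁ * volume (Metric.closedBall (0 : Plane) a₁)
  have hD : D ≠ 0 := mul_ne_zero (secondMoment_ne_zero hs' hs1) hA.volume_ball_ne_zero
  have hq : Tendsto (fun y => markMeasure α 0 r₁ Q {m | ¬ (Covers x m ↔ Covers y m)} / D)
      (𝓝 x) (𝓝 0) := by
    have := ENNReal.Tendsto.div_const
      (tendsto_markMeasure_covers_one x hα hfin hA.outer hA.frontier_null) (Or.inr hD)
    rwa [ENNReal.zero_div] at this
  refine tendsto_zero_of_le_exp hq fun K hK => Eventually.of_forall fun y => ?_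
  set G : Set (Fin 2 → ℝ) := {v | v 0 ≠ v 1}
  have hG : IsOpen G := isOpen_ne_fun (continuous_apply 0) (continuous_apply 1)
  set p : Fin 2 → Plane := ![x, y]
  have hfidi := hI 2 p
  have h1 := ProbabilityMeasure.le_liminf_measure_open_of_tendsto hfidi.tendsto hG
  calc P' {ω | ε ≤ edist (I y ω) (I x ω)}
      ≤ (P'.map fun ω k => I (p k) ω) G := by
        rw [Measure.map_apply_of_aemeasurable hfidi.aemeasurable_limit hG.measurableSet]
        refine measure_mono fun ω hω heq => ?_
        have heq' : I x ω = I y ω := heq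
        have hω' : ε ≤ edist (I y ω) (I x ω) := hω
        rw [heq', edist_self] at hω'
        exact absurd hω' (not_le.2 hε)
    _ ≤ _ := h1
    _ ≤ _ := by
        refine liminf_le_of_frequently_le' (Eventually.frequently ?_)
        have hev : ∀ᶠ r₀ : Cutoff r₁ in cutoffFilter r₁, (r₀ : ℝ) ≤ s :=
          (tendsto_cutoff r₁).eventually (Ioc_mem_nhdsGT hs') |>.mono fun _ h => h.2
        filter_upwards [hev] with r₀ hr₀
        change ((P r₀).map fun ω k => coloredField (Φ r₀) (U r₀) (p k) ω) G ≤ _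
        rw [Measure.map_apply_of_aemeasurable (hfidi.forall_aemeasurable r₀) hG.measurableSet]
        refine (measure_mono_ae ?_).trans ((hA.measure_topIndex_ne_le r₀.2.1 r₀.2.2
          (hmodel r₀).leaves x y hK).trans ?_)
        · filter_upwards [hA.coloredField_ae_eq r₀.2.1 r₀.2.2 (hmodel r₀).leaves (U r₀) x,
            hA.coloredField_ae_eq r₀.2.1 r₀.2.2 (hmodel r₀).leaves (U r₀) y] with ω hx hy hω heq
          have hω' : coloredField (Φ r₀) (U r₀) x ω ≠ coloredField (Φ r₀) (U r₀) y ω := hω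
          rw [hx, hy] at hω'
          exact hω' (by rw [heq])
        · gcongr
          · exact markMeasure_mono r₀.2.1.le
          · exact (mul_le_mul_left (secondMoment_anti hr₀) _).trans
              (le_markMeasure_covers x r₀.2.1 hA.inner)

end Limit

/-! ### Stochastically continuous random fields -/

section Modification

variable {Ω : Type*} [MeasurableSpace Ω] {P : Measure Ω} {Z : Plane → Ω → ℝ}

/-- A stochastically continuous field is approximated in probability, uniformly over the plane, by
jointly measurable fields, which are constant on the cells of a countable partition. -/
lemma StochasticallyContinuous.exists_approx (hZ : StochasticallyContinuous Z P)
    (hm : ∀ x, Measurable (Z x)) {ε : ℝ≥0∞} (hε : 0 < ε) :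
    ∃ Y : Plane → Ω → ℝ, Measurable (fun p : Ω × Plane => Y p.2 p.1) ∧
      ∀ y, P {ω | ε ≤ edist (Z y ω) (Y y ω)} ≤ ε := by
  classical
  set V : Plane → Set Plane := fun x => interior {y | P {ω | ε ≤ edist (Z y ω) (Z x ω)} ≤ ε}
  have hV : ∀ x, V x ∈ 𝓝 x := fun x =>
    interior_mem_nhds.2 (ENNReal.tendsto_nhds_zero.1 (hZ x ε hε) ε hε)
  obtain ⟨s, hsc, hs⟩ := TopologicalSpace.countable_cover_nhds hV
  have hne : s.Nonempty := by
    obtain ⟨x, hx, -⟩ := Set.mem_iUnion₂.1 (hs.symm.subset (Set.mem_univ (0 : Plane)))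
    exact ⟨x, hx⟩
  obtain ⟨u, rfl⟩ := hsc.exists_eq_range hne
  have hex : ∀ y, ∃ k, y ∈ V (u k) := fun y => by
    have := hs.symm.subset (Set.mem_univ y)
    simpa using this
  have hk : Measurable fun y => Nat.find (hex y) :=
    measurable_find hex fun k => isOpen_interior.measurableSet
  have hmu : Measurable fun p : Ω × ℕ => Z (u p.2) p.1 :=
    measurable_from_prod_countable_left fun k => hm (u k)
  refine ⟨fun y => Z (u (Nat.find (hex y))),
    hmu.comp (measurable_fst.prodMk (hk.comp measurable_snd)), fun y => ?_⟩
  exact interior_subset (s := {y' | P {ω | ε ≤ edist (Z y' ω) (Z (u (Nat.find (hex y))) ω)} ≤ ε})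
    (Nat.find_spec (hex y))

/-- By the Borel–Cantelli lemma the approximations converge almost surely at every point. -/
lemma StochasticallyContinuous.hasMeasurableModification (hZ : StochasticallyContinuous Z P)
    (hm : ∀ x, Measurable (Z x)) : HasMeasurableModification Z P := by
  have hε : ∀ n : ℕ, (0 : ℝ≥0∞) < 2⁻¹ ^ n := fun n => by simp [ENNReal.pow_pos]
  choose Y hY hYZ using fun n => hZ.exists_approx hm (hε n)
  refine ⟨fun x ω => limsup (fun n => Y n x ω) atTop, Measurable.limsup hY, fun x => ?_⟩
  have hsum : ∑' n : ℕ, P {ω | 2⁻¹ ^ n ≤ edist (Z x ω) (Y n x ω)} ≠ ∞ := by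
    refine ne_top_of_le_ne_top ?_ (ENNReal.tsum_le_tsum fun n => hYZ n x)
    rw [ENNReal.tsum_geometric]
    simp
  filter_upwards [ae_eventually_notMem hsum] with ω hω
  refine Tendsto.limsup_eq (tendsto_iff_edist_tendsto_0.2 ?_)
  have hpow : Tendsto (fun n : ℕ => (2⁻¹ : ℝ≥0∞) ^ n) atTop (𝓝 0) :=
    ENNReal.tendsto_pow_atTop_nhds_zero_of_lt_one (by simp)
  refine tendsto_of_tendsto_of_tendsto_of_le_of_le' tendsto_const_nhds hpow
    (Eventually.of_forall fun _ => zero_le) ?_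
  filter_upwards [hω] with n hn
  rw [edist_comm]
  exact (not_le.1 hn).le

end Modification

/-! ### White noise -/

section Orthogonal

variable {Ω X : Type*} [MeasurableSpace Ω] {P : Measure Ω} [IsProbabilityMeasure P]
  [MeasurableSpace X] [MeasurableEq X] {W : X → Ω → ℝ}

/-- The second moment of the integral of an orthogonal field is an integral over the diagonal. -/
lemma ae_integral_eq_zero_of_orthogonal (κ : Measure X) [IsFiniteMeasure κ] [NullSingletonClass κ]
    (hW : Measurable fun p : Ω × X => W p.2 p.1) (hb : ∀ x ω, |W x ω| ≤ 1)
    (horth : ∀ x y, x ≠ y → ∫ ω, W x ω * W y ω ∂P = 0) :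
    ∀ᵐ ω ∂P, ∫ x, W x ω ∂κ = 0 := by
  have hsq : ∀ ω, (∫ x, W x ω ∂κ) ^ 2 = ∫ q : X × X, W q.1 ω * W q.2 ω ∂κ.prod κ := fun ω => by
    rw [integral_prod_mul (fun x => W x ω) fun x => W x ω, sq]
  have hm3 : Measurable fun p : Ω × X × X => W p.2.1 p.1 * W p.2.2 p.1 :=
    (hW.comp (measurable_fst.prodMk (measurable_fst.comp measurable_snd))).mul
      (hW.comp (measurable_fst.prodMk (measurable_snd.comp measurable_snd)))
  have hint3 : Integrable (fun p : Ω × X × X => W p.2.1 p.1 * W p.2.2 p.1)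
      (P.prod (κ.prod κ)) := by
    refine Integrable.of_bound hm3.aestronglyMeasurable 1 (Eventually.of_forall fun p => ?_)
    rw [Real.norm_eq_abs, abs_mul]
    exact mul_le_one₀ (hb _ _) (abs_nonneg _) (hb _ _)
  have hdiag : ∀ᵐ q ∂κ.prod κ, q.1 ≠ q.2 := by
    have := (Measure.measure_prod_null (μ := κ) (ν := κ) measurableSet_diagonal).2
      (Eventually.of_forall fun x => by
        have : Prod.mk x ⁻¹' Set.diagonal X = {x} := by ext y; simp [eq_comm]
        simp [this])
    exact measure_mono_null (fun q hq => not_not.1 hq) this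
  have hzero : ∫ ω, (∫ x, W x ω ∂κ) ^ 2 ∂P = 0 := by
    simp_rw [hsq]
    rw [integral_integral_swap (f := fun ω (q : X × X) => W q.1 ω * W q.2 ω) hint3]
    refine integral_eq_zero_of_ae ?_
    filter_upwards [hdiag] with q hq using horth _ _ hq
  have hint : Integrable (fun ω => (∫ x, W x ω ∂κ) ^ 2) P := by
    simp_rw [hsq]
    exact hint3.integral_prod_left
  have := (integral_eq_zero_iff_of_nonneg (fun ω => sq_nonneg _) hint).1 hzero
  filter_upwards [this] with ω hω using pow_eq_zero_iff two_ne_zero |>.1 hω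

/-- A jointly measurable field with orthogonal values vanishes at almost every point, since its
integrals over all measurable rectangles vanish. -/
lemma ae_ae_eq_zero_of_orthogonal (κ : Measure X) [IsFiniteMeasure κ] [NullSingletonClass κ]
    (hW : Measurable fun p : Ω × X => W p.2 p.1) (hb : ∀ x ω, |W x ω| ≤ 1)
    (horth : ∀ x y, x ≠ y → ∫ ω, W x ω * W y ω ∂P = 0) :
    ∀ᵐ x ∂κ, ∀ᵐ ω ∂P, W x ω = 0 := by
  have hint : Integrable (fun p : Ω × X => W p.2 p.1) (P.prod κ) :=
    Integrable.of_bound hW.aestronglyMeasurable 1 (Eventually.of_forall fun p => hb _ _)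
  have hrect : ∀ (E : Set Ω) (A : Set X), ∫ p in E ×ˢ A, W p.2 p.1 ∂P.prod κ = 0 := by
    intro E A
    rw [setIntegral_prod _ hint.integrableOn]
    refine integral_eq_zero_of_ae (ae_restrict_of_ae ?_)
    exact ae_integral_eq_zero_of_orthogonal (κ.restrict A) hW hb horth
  have hset : ∀ C : Set (Ω × X), MeasurableSet C → ∫ p in C, W p.2 p.1 ∂P.prod κ = 0 := by
    intro C hC
    induction C, hC using MeasurableSpace.induction_on_inter generateFrom_prod.symm
      isPiSystem_prod with
    | empty => simp
    | basic t ht =>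
      obtain ⟨E, -, A, -, rfl⟩ := ht
      exact hrect E A
    | compl t htm ih =>
      have h1 := integral_add_compl htm hint
      have h2 := hrect Set.univ Set.univ
      rw [Set.univ_prod_univ, setIntegral_univ] at h2
      linarith
    | iUnion f hd hfm ih =>
      rw [integral_iUnion hfm hd hint.integrableOn]
      simp [ih]
  have h0 := hint.ae_eq_zero_of_forall_setIntegral_eq_zero fun C hC _ => hset C hC
  have hm : MeasurableSet {q : X × Ω | W q.1 q.2 = 0} :=
    (hW.comp measurable_swap) (measurableSet_singleton 0)
  exact (Measure.ae_ae_comm hm).2 (Measure.ae_ae_of_ae_prod h0)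

end Orthogonal

section WhiteNoise

variable {Ω : Type*} [MeasurableSpace Ω] {P : Measure Ω}
  {Z : Plane → Ω → ℝ}

/-- Two independent uniform variables differ by at least `1 / 2` with probability at least
`1 / 16`. -/
lemma IsWhiteNoise.not_stochasticallyContinuous (hZ : IsWhiteNoise Z uniformLaw P) :
    ¬ StochasticallyContinuous Z P := by
  intro h
  have h1 := ENNReal.tendsto_nhds_zero.1 (h 0 (ENNReal.ofReal (1 / 2)) (by simp))
    (ENNReal.ofReal (1 / 32)) (by simp)
  have h2 : ∀ᶠ y in 𝓝[≠] (0 : Plane), y ≠ 0 := eventually_mem_nhdsWithin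
  obtain ⟨y, hy, hy0⟩ := ((h1.filter_mono nhdsWithin_le_nhds).and h2).exists
  have hind := (hZ.1.indepFun hy0).measure_inter_preimage_eq_mul (Set.Icc 0 (1 / 4))
    (Set.Icc (3 / 4) 1) measurableSet_Icc measurableSet_Icc
  have hlo : P (Z y ⁻¹' Set.Icc 0 (1 / 4)) = ENNReal.ofReal (1 / 4) := by
    refine ((hZ.2 y).measure_eq (p := (· ∈ Set.Icc 0 (1 / 4))) measurableSet_Icc).trans ?_
    change uniformLaw (Set.Icc 0 (1 / 4)) = _
    rw [uniformLaw, Measure.restrict_apply measurableSet_Icc, Set.Icc_inter_Icc, Real.volume_Icc]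
    norm_num
  have hhi : P (Z 0 ⁻¹' Set.Icc (3 / 4) 1) = ENNReal.ofReal (1 / 4) := by
    refine ((hZ.2 0).measure_eq (p := (· ∈ Set.Icc (3 / 4) 1)) measurableSet_Icc).trans ?_
    change uniformLaw (Set.Icc (3 / 4) 1) = _
    rw [uniformLaw, Measure.restrict_apply measurableSet_Icc, Set.Icc_inter_Icc, Real.volume_Icc]
    norm_num
  rw [hlo, hhi, ← ENNReal.ofReal_mul (by norm_num)] at hind
  have hle : P (Z y ⁻¹' Set.Icc 0 (1 / 4) ∩ Z 0 ⁻¹' Set.Icc (3 / 4) 1) ≤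
      P {ω | ENNReal.ofReal (1 / 2) ≤ edist (Z y ω) (Z 0 ω)} := by
    refine measure_mono fun ω hω => ?_
    have ha : Z y ω ≤ 1 / 4 := hω.1.2
    have hb : 3 / 4 ≤ Z 0 ω := hω.2.1
    change _ ≤ edist (Z y ω) (Z 0 ω)
    rw [edist_dist, Real.dist_eq, abs_sub_comm]
    exact ENNReal.ofReal_le_ofReal ((by linarith : (1 : ℝ) / 2 ≤ Z 0 ω - Z y ω).trans
      (le_abs_self _))
  rw [hind] at hle
  have := (ENNReal.ofReal_le_ofReal_iff (by norm_num)).1 (hle.trans hy)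
  norm_num at this

variable [IsProbabilityMeasure P]

/-- A jointly measurable modification, centered at the mean, would be an orthogonal field, hence
vanish at almost every point. -/
lemma IsWhiteNoise.not_hasMeasurableModification (hZ : IsWhiteNoise Z uniformLaw P) :
    ¬ HasMeasurableModification Z P := by
  rintro ⟨Z', hZ', hmod⟩
  -- Truncation to `[0, 1]` makes the modification bounded without changing it almost surely.
  set φ : ℝ → ℝ := fun t => max 0 (min 1 t) - 1 / 2 with hφ
  have hφm : Measurable φ := by fun_prop
  have hφb : ∀ t, |φ t| ≤ 1 := fun t => by
    rw [abs_le]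
    have h1 : max 0 (min 1 t) ≤ 1 := max_le zero_le_one (min_le_left _ _)
    have h2 : 0 ≤ max 0 (min 1 t) := le_max_left _ _
    constructor <;> simp only [hφ] <;> linarith
  have hmean : ∀ x, ∫ ω, φ (Z x ω) ∂P = 0 := fun x => by
    refine ((hZ.2 x).integral_comp hφm.aestronglyMeasurable).trans ?_
    have : ∫ t, φ t ∂uniformLaw = ∫ t in Set.Icc (0 : ℝ) 1, (t - 1 / 2) := by
      refine setIntegral_congr_fun measurableSet_Icc fun t ht => ?_
      simp [hφ, min_eq_right ht.2, max_eq_right ht.1]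
    rw [this, integral_Icc_eq_integral_Ioc, ← intervalIntegral.integral_of_le zero_le_one]
    rw [intervalIntegral.integral_sub (by simp) (by simp)]
    norm_num
  -- Any finite nonzero diffuse measure would do.
  set κ : Measure Plane := volume.restrict (Metric.closedBall 0 1) with hκ
  have : IsFiniteMeasure κ := ⟨by simp [hκ]⟩
  have hzero := ae_ae_eq_zero_of_orthogonal (P := P) (W := fun x ω => φ (Z' x ω)) κ
    (hφm.comp hZ') (fun x ω => hφb _) fun x y hxy => by
      have h1 : ∫ ω, φ (Z' x ω) * φ (Z' y ω) ∂P = ∫ ω, φ (Z x ω) * φ (Z y ω) ∂P := by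
        refine integral_congr_ae ?_
        filter_upwards [hmod x, hmod y] with ω hx hy
        rw [hx, hy]
      have h2 := ((hZ.1.indepFun hxy).comp hφm hφm).integral_fun_mul_eq_mul_integral
        (hφm.comp_aemeasurable (hZ.2 x).aemeasurable).aestronglyMeasurable
        (hφm.comp_aemeasurable (hZ.2 y).aemeasurable).aestronglyMeasurable
      rw [h1]
      refine h2.trans ?_
      exact mul_eq_zero_of_left (hmean x) _
  have hκ0 : κ ≠ 0 := by
    rw [hκ, Ne, Measure.restrict_eq_zero]
    exact (Metric.measure_closedBall_pos _ _ one_pos).ne'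
  have : (ae κ).NeBot := ae_neBot.2 hκ0
  obtain ⟨x, hx⟩ := hzero.exists
  have hhalf : ∀ᵐ ω ∂P, Z x ω = 1 / 2 := by
    filter_upwards [hx, hmod x] with ω hω hωx
    rw [hωx] at hω
    have h1 : max 0 (min 1 (Z x ω)) = 1 / 2 := sub_eq_zero.1 hω
    rcases max_choice 0 (min 1 (Z x ω)) with h2 | h2
    · rw [h2] at h1; norm_num at h1
    · rw [h2] at h1
      rcases min_choice 1 (Z x ω) with h3 | h3
      · rw [h3] at h1; norm_num at h1
      · rw [← h3, h1]
  have h1 : P {ω | Z x ω = 1 / 2} = 0 := by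
    refine ((hZ.2 x).measure_eq (p := (· = 1 / 2)) (measurableSet_singleton _)).trans ?_
    change uniformLaw {1 / 2} = 0
    simp [uniformLaw]
  have h2 : P {ω | Z x ω = 1 / 2} = 1 := by
    rw [← measure_univ (μ := P)]
    exact measure_congr (eventuallyEq_univ.2 hhalf)
  rw [h1] at h2
  exact zero_ne_one h2

end WhiteNoise

end DeadLeaves

theorem mainTheorem10
    -- the scaling exponent and the upper cut-off `r₁ ∈ (0, ∞]`, finite when `α ≤ 3`
    (α : ℝ) (hα : 1 < α) (r₁ : ℝ≥0∞) (hr₁ : 0 < r₁) (hr₁_fin : α ≤ 3 → r₁ ≠ ∞)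
    -- the law `Q` of the random compact set `Y`
    (Q : Measure (Closeds DeadLeaves.Plane)) [IsProbabilityMeasure Q]
    (hQ : ∃ a₁ a₂ : ℝ, 0 < a₁ ∧ a₁ < a₂ ∧ ∀ᵐ Y : Closeds DeadLeaves.Plane ∂Q,
      Metric.closedBall (0 : DeadLeaves.Plane) a₁ ⊆ (Y : Set DeadLeaves.Plane) ∧
      (Y : Set DeadLeaves.Plane) ⊆ Metric.closedBall (0 : DeadLeaves.Plane) a₂)
    (hQ_frontier : ∀ᵐ Y : Closeds DeadLeaves.Plane ∂Q, volume (frontier (Y : Set DeadLeaves.Plane)) = 0)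
    -- for each `r₀ ∈ (0, r₁)`, a realization of the uniformly colored model `I(r₀, r₁)`
    {Ω : DeadLeaves.Cutoff r₁ → Type*} [∀ r₀, MeasurableSpace (Ω r₀)]
    (P : ∀ r₀, Measure (Ω r₀)) [∀ r₀, IsProbabilityMeasure (P r₀)]
    (Φ : ∀ r₀, ℕ → Ω r₀ → DeadLeaves.Leaf) (U : ∀ r₀, ℕ → Ω r₀ → ℝ)
    (hmodel : ∀ r₀ : DeadLeaves.Cutoff r₁,
      DeadLeaves.IsUniformlyColoredDeadLeaves (P r₀) α r₀ r₁ Q (Φ r₀) (U r₀))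
    -- a random field `I = I(0, r₁)`, the limit of `I(r₀, r₁)` as `r₀ → 0`
    {Ω' : Type*} [MeasurableSpace Ω'] (P' : Measure Ω') [IsProbabilityMeasure P']
    (I : DeadLeaves.Plane → Ω' → ℝ) (hI_meas : ∀ x, Measurable (I x))
    (hI : DeadLeaves.TendstoFidi (fun r₀ => DeadLeaves.coloredField (Φ r₀) (U r₀))
      (Filter.comap (fun r₀ : DeadLeaves.Cutoff r₁ => (r₀ : ℝ)) (𝓝 0)) I P P') :
    (DeadLeaves.StochasticallyContinuous I P' ↔ α ∈ Set.Ioo (1 : ℝ) 3) ∧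
    (DeadLeaves.HasMeasurableModification I P' ↔ α ∈ Set.Ioo (1 : ℝ) 3) ∧
    (3 ≤ α → DeadLeaves.IsWhiteNoise I DeadLeaves.uniformLaw P') := by
  obtain ⟨a₁, a₂, h₁, h₂, hY⟩ := hQ
  have hA : DeadLeaves.Admissible α r₁ Q a₁ a₂ :=
    ⟨hα, hr₁_fin, h₁, h₁.trans h₂, hY.mono fun _ h => h.1, hY.mono fun _ h => h.2, hQ_frontier⟩
  have hcont : α < 3 → DeadLeaves.StochasticallyContinuous I P' := fun h =>
    hA.stochasticallyContinuous hr₁ h hmodel hI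
  have hnoise : 3 ≤ α → DeadLeaves.IsWhiteNoise I DeadLeaves.uniformLaw P' := fun h =>
    hA.isWhiteNoise hr₁ h hmodel hI
  refine ⟨⟨fun h => ⟨hα, ?_⟩, fun h => hcont h.2⟩,
    ⟨fun h => ⟨hα, ?_⟩, fun h => (hcont h.2).hasMeasurableModification hI_meas⟩, hnoise⟩
  · exact not_le.1 fun h3 => (hnoise h3).not_stochasticallyContinuous h
  · exact not_le.1 fun h3 => (hnoise h3).not_hasMeasurableModification h
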